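/- **Setting.** Let $n\ge 1$, let $\mathbb E^{n+1}$ be Euclidean space and $G=SE(n+1)=\mathbb R^{n+1}\rtimes SO(n+1)$. Let $J^l=J^l(n,\mathbb E^{n+1})$ be the space of $l$-jets $[S]^l_p$ of smooth embedded hypersurfaces, with $\pi_{2,1}:J^2\to J^1$ and the prolonged action $g\cdot[S]^l_p=[gS]^l_{gp}$. Let $\tilde J^2$ be the space of cooriented 2-jets, i.e. of pairs $([S]^2_p,\xi)$ where $\xi$ is one of the two unit covectors with $\ker\xi=T_pS$; $G$ acts on it by $g\cdot(a,\xi)=(g\cdot a,\xi\circ(dg)^{-1})$. A *second-order PDE* is a closed smooth embedded hypersurface $\mathcal E$ of $J^2$ (or of $\tilde J^2$, in the cooriented setting); it is $G$-invariant if $g\cdot\mathcal E\subseteq\mathcal E$ for all $g\in G$. **Theorem.** The map $[S]^1_p\mapsto(p,[\xi])$ with $\ker\xi=T_pS$ is a bijection $J^1\simeq\mathbb P T^*\mathbb E^{n+1}$. Let $[\xi]\in\mathbb P T^*_p\mathbb E^{n+1}\simeq J^1$, with representative $\xi$ normalised by $|\xi|=1$, let $V=\ker\xi$, and let $N$ be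 the unit normal dual to $\xi$. 1. Sending $[S]^2_p$ to the second fundamental form of $S$ at $p$ with respect to $N$ is a bijection of the fibre $J^2_{[\xi]}=\pi_{2,1}^{-1}([\xi])$ onto the space $S^2V^*$ of symmetric bilinear forms; it is a linear isomorphism in the second-order jet coordinates $(u_{ij})$ of any Euclidean coordinate system $(u,x^1,\dots,x^n)$ whose jet chart contains $[\xi]$. 2. A function $F:S^2V^*\to\mathbb R$ is $SO(V)$-invariant if and only if $F=\Phi(\sigma_1,\dots,\sigma_n)$ for some function $\Phi:\mathbb R^n\to\mathbb R$, where $\sigma_1,\dots,\sigma_n$ are the elementary symmetric functions of the principal curvatures, i.e. of the eigenvalues of $g^{-1}\circ\beta$, $\beta\in S^2V^*$, with $g$ the metric of $V$. 3. (Cooriented hypersurfaces.) Every $SO(V)$-invariant $F$ on $S^2V^*$ has a unique extension to a $G$-invariant function $\hat F$ on $\tilde J^2$ (that is, $\hat F=F$ on the fibre over $(p,\xi)$). If $F=\Phi(\sigma_1,\dots,\sigma_n)$, then $\hat F$ is $\Phi$ of the elementary symmetric functions of the principal curvatures at every point of $\tilde J^2$; if $F$ is smooth, so is $\hat F$. The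 set $\mathcal E=\{\hat F=0\}$ is $G$-invariant, and if $\{F=0\}$ is a closed smooth hypersurface of $S^2V^*$, then $\mathcal E$ is a second-order PDE, transversal to the fibres over the 1-jets (it has local equations with nonzero derivative in the direction of the $u_{ij}$). Conversely, every $G$-invariant second-order PDE in $\tilde J^2$ equals $\{\hat F=0\}$ for some $F=\Phi(\sigma_1,\dots,\sigma_n)$ with $\Phi:\mathbb R^n\to\mathbb R$ smooth and $\{F=0\}$ a closed smooth hypersurface of $S^2V^*$. 4. (Hypersurfaces without coorientation.) An $SO(V)$-invariant $F$ on $S^2V^*$ has a $G$-invariant extension $\hat F$ to $J^2$ if and only if $F(-\beta)=F(\beta)$ for all $\beta$, and then the extension is unique. For such $F$, the remaining assertions of 3 hold with $J^2$ in place of $\tilde J^2$ (with the principal curvatures taken with respect to either unit conormal). Conversely, every $G$-invariant second-order PDE in $J^2$ equals $\{\hat F=0\}$ for some such $F=\Phi(\sigma_1,\dots,\sigma_n)$ with $\Phi$ smooth and $\{F=0\}$ a closed smooth hypersurface of $S^2V^*$. -/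

import Mathlib

set_option maxSynthPendingDepth 3

open scoped ContDiff Topology

noncomputable section

namespace EuclideanJets

/-! ### Euclidean space, Euclidean coordinates and the group of motions -/

/-- The Euclidean space `ℝᵐ`. -/
abbrev Euc (m : ℕ) := EuclideanSpace ℝ (Fin m)

/-- Covectors of `𝔼ⁿ⁺¹`, with the norm dual to the Euclidean one. -/
abbrev Covector (n : ℕ) := Euc (n + 1) →L[ℝ] ℝ

/-- Affine isometries of `𝔼ⁿ⁺¹`. They serve both as motions and as systems of Euclidean
coordinates: for a coordinate system `c`, the coordinates `(u, x)` of a point `q` are the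
zeroth entry and the remaining `n` entries of `c q`. -/
abbrev Isom (n : ℕ) := Euc (n + 1) ≃ᵃⁱ[ℝ] Euc (n + 1)

/-- The entries `1, …, n` of a vector of `ℝⁿ⁺¹`. -/
def tail {n : ℕ} (v : Euc (n + 1)) : Euc n := WithLp.toLp 2 (fun i => v i.succ)

/-- The vector of `ℝⁿ⁺¹` with zeroth entry `u` and remaining entries `x`. -/
def join {n : ℕ} (u : ℝ) (x : Euc n) : Euc (n + 1) :=
  WithLp.toLp 2 (Fin.cons u (fun i => x i) : Fin (n + 1) → ℝ)

/-- The coordinate `u` of `q`. -/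
def ucoord {n : ℕ} (c : Isom n) (q : Euc (n + 1)) : ℝ := c q 0

/-- The coordinates `x = (x¹, …, xⁿ)` of `q`. -/
def xcoord {n : ℕ} (c : Isom n) (q : Euc (n + 1)) : Euc n := tail (c q)

/-- The special Euclidean group `SE(n+1) = ℝⁿ⁺¹ ⋊ SO(n+1)`. -/
def SE (n : ℕ) : Subgroup (Isom n) where
  carrier := {g | LinearMap.det
    (g.linearIsometryEquiv.toLinearEquiv : Euc (n + 1) →ₗ[ℝ] Euc (n + 1)) = 1}
  one_mem' := by
    show LinearMap.det (LinearMap.id : Euc (n + 1) →ₗ[ℝ] Euc (n + 1)) = 1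
    exact LinearMap.det_id
  mul_mem' := by
    intro g h hg hh
    have e : ((g * h).linearIsometryEquiv.toLinearEquiv : Euc (n + 1) →ₗ[ℝ] Euc (n + 1)) =
        (g.linearIsometryEquiv.toLinearEquiv : Euc (n + 1) →ₗ[ℝ] Euc (n + 1)) ∘ₗ
          (h.linearIsometryEquiv.toLinearEquiv : Euc (n + 1) →ₗ[ℝ] Euc (n + 1)) := rfl
    simp only [Set.mem_ofPred_eq] at hg hh ⊢
    rw [e, LinearMap.det_comp, hg, hh, one_mul]
  inv_mem' := by
    intro g hg
    have e : ((g⁻¹).linearIsometryEquiv.toLinearEquiv : Euc (n + 1) →ₗ[ℝ] Euc (n + 1)) =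
        (g.linearIsometryEquiv.toLinearEquiv.symm : Euc (n + 1) →ₗ[ℝ] Euc (n + 1)) := rfl
    simp only [Set.mem_ofPred_eq] at hg ⊢
    rw [e]
    have h := LinearEquiv.det_symm_mul_det g.linearIsometryEquiv.toLinearEquiv
    rwa [hg, mul_one] at h

/-! ### Hypersurfaces and their jets -/

/-- Near `p`, the set `S` is the graph `u = f(x)` of a smooth function `f` in the Euclidean
coordinates `c`. (A locally defined `f` can be cut off, so `f` may be taken globally smooth.) -/
def IsGraphAt {n : ℕ} (c : Isom n) (S : Set (Euc (n + 1))) (p : Euc (n + 1))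
    (f : Euc n → ℝ) : Prop :=
  ContDiff ℝ ∞ f ∧ ∀ᶠ q in 𝓝 p, (q ∈ S ↔ ucoord c q = f (xcoord c q))

/-- Smooth embedded hypersurfaces of `𝔼ⁿ⁺¹`. -/
def IsHypersurface {n : ℕ} (S : Set (Euc (n + 1))) : Prop :=
  ∀ p ∈ S, ∃ (c : Isom n) (f : Euc n → ℝ), IsGraphAt c S p f

/-- A hypersurface of `𝔼ⁿ⁺¹` together with one of its points. -/
structure PointedHypersurface (n : ℕ) where
  S : Set (Euc (n + 1))
  p : Euc (n + 1)
  isHypersurface : IsHypersurface S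
  mem : p ∈ S

/-- `l`-equivalence of hypersurfaces through the same point: in coordinates admissible for both
they are the graphs of functions with the same Taylor expansion up to order `l`. -/
def LEquiv {n : ℕ} (l : ℕ) (X Y : PointedHypersurface n) : Prop :=
  X.p = Y.p ∧ ∃ (c : Isom n) (f g : Euc n → ℝ),
    IsGraphAt c X.S X.p f ∧ IsGraphAt c Y.S Y.p g ∧
      ∀ k ≤ l, iteratedFDeriv ℝ k f (xcoord c X.p) = iteratedFDeriv ℝ k g (xcoord c X.p)

/-- The space `Jˡ(n, 𝔼ⁿ⁺¹)` of `l`-jets of hypersurfaces. (`LEquiv` is already an equivalence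
relation, since the Taylor condition does not depend on the admissible coordinates.) -/
def Jet (n l : ℕ) := Quot (LEquiv (n := n) l)

/-- The `l`-jet `[S]ˡ_p`. -/
def jet {n : ℕ} (l : ℕ) (X : PointedHypersurface n) : Jet n l := Quot.mk _ X

/-- The projection `Jˡ → 𝔼ⁿ⁺¹`. -/
def Jet.base {n l : ℕ} : Jet n l → Euc (n + 1) :=
  Quot.lift (fun X => X.p) (fun _ _ h => h.1)

/-- The projection `π_{2,1} : J² → J¹`. -/
def Jet.proj {n : ℕ} : Jet n 2 → Jet n 1 :=
  Quot.map id (fun _ _ h => by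
    obtain ⟨hp, c, f, g, hf, hg, hk⟩ := h
    exact ⟨hp, c, f, g, hf, hg, fun k hk1 => hk k (by omega)⟩)

lemma IsGraphAt.image {n : ℕ} {c : Isom n} {S : Set (Euc (n + 1))} {p : Euc (n + 1)}
    {f : Euc n → ℝ} (h : IsGraphAt c S p f) (g : Isom n) :
    IsGraphAt (g.symm.trans c) (g '' S) (g p) f := by
  refine ⟨h.1, ?_⟩
  have hc : Filter.Tendsto g.symm (𝓝 (g p)) (𝓝 p) := by
    have := g.symm.continuous.tendsto (g p)
    rwa [g.symm_apply_apply] at this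
  filter_upwards [hc.eventually h.2] with q hq
  have e : q ∈ g '' S ↔ g.symm q ∈ S := by
    constructor
    · rintro ⟨y, hy, rfl⟩
      rwa [g.symm_apply_apply]
    · intro hy
      exact ⟨_, hy, g.apply_symm_apply q⟩
  rw [e, hq]
  rfl

/-- The image of a pointed hypersurface under a motion. -/
def PointedHypersurface.move {n : ℕ} (g : Isom n) (X : PointedHypersurface n) :
    PointedHypersurface n where
  S := g '' X.S
  p := g X.p
  isHypersurface := by
    rintro _ ⟨q, hq, rfl⟩
    obtain ⟨c, f, h⟩ := X.isHypersurface q hq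
    exact ⟨_, f, h.image g⟩
  mem := ⟨X.p, X.mem, rfl⟩

/-- The prolonged action on jets, `g · [S]ˡ_p = [g S]ˡ_{g p}`. -/
def Jet.move {n l : ℕ} (g : Isom n) : Jet n l → Jet n l :=
  Quot.map (PointedHypersurface.move g) (fun X Y h => by
    obtain ⟨hp, c, f₁, f₂, h₁, h₂, hk⟩ := h
    refine ⟨congrArg g hp, g.symm.trans c, f₁, f₂, h₁.image g, h₂.image g, ?_⟩
    have e : xcoord (g.symm.trans c) (PointedHypersurface.move g X).p = xcoord c X.p := by
      show tail (c (g.symm (g X.p))) = tail (c X.p)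
      rw [g.symm_apply_apply]
    rw [e]
    exact hk)

/-! ### Tangent hyperplanes, conormals, second fundamental form -/

/-- `γ` is a smooth curve that lies in the hypersurface for small times and is at the marked
point at time `0`. -/
def PointedHypersurface.IsCurve {n : ℕ} (X : PointedHypersurface n)
    (γ : ℝ → Euc (n + 1)) : Prop :=
  ContDiff ℝ ∞ γ ∧ γ 0 = X.p ∧ ∀ᶠ t in 𝓝 (0 : ℝ), γ t ∈ X.S

/-- `ξ` is a nonzero covector annihilating the tangent space `T_p S`. -/
def PointedHypersurface.IsConormal {n : ℕ} (X : PointedHypersurface n) (ξ : Covector n) : Prop :=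
  ξ ≠ 0 ∧ ∀ γ, X.IsCurve γ → ξ (deriv γ 0) = 0

/-- `ξ` is a conormal of the 1-jet `a`, that is, `a = [S]¹_p` with `ker ξ = T_p S`. -/
def IsConormal {n : ℕ} (a : Jet n 1) (ξ : Covector n) : Prop :=
  ∃ X : PointedHypersurface n, jet 1 X = a ∧ X.IsConormal ξ

/-- Conormals of length one; every 1-jet has exactly two of them, `ξ` and `-ξ`. -/
def IsUnitConormal {n : ℕ} (a : Jet n 1) (ξ : Covector n) : Prop :=
  IsConormal a ξ ∧ ‖ξ‖ = 1

/-- The space `S²W*` of symmetric bilinear forms on `W`, with the operator norm. -/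
def SymBil (W : Type*) [NormedAddCommGroup W] [NormedSpace ℝ W] :
    Submodule ℝ (W →L[ℝ] W →L[ℝ] ℝ) where
  carrier := {β | ∀ v w, β v w = β w v}
  add_mem' := by
    intro a b ha hb v w
    simp [ha v w, hb v w]
  zero_mem' := by
    intro v w
    simp
  smul_mem' := by
    intro r a ha v w
    simp [ha v w]

/-- The hyperplane `V = ker ξ`. -/
abbrev Hyp {n : ℕ} (ξ : Covector n) : Submodule ℝ (Euc (n + 1)) :=
  LinearMap.ker (ξ : Euc (n + 1) →ₗ[ℝ] ℝ)

/-- `β` is the second fundamental form of `S` at `p` with respect to the unit normal `N` dual to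
the unit conormal `ξ`: for every curve `γ` in `S` through `p`, `β(γ'(0), γ'(0)) = ⟨γ''(0), N⟩`.
For a graph `u = f(x)` with upward normal this gives
`β = (1 + |df|²)^(-1/2) ∑ f_{ij} dxⁱ dxʲ`. -/
def PointedHypersurface.IsSFF {n : ℕ} (X : PointedHypersurface n) (ξ : Covector n)
    (β : SymBil (Hyp ξ)) : Prop :=
  ∀ γ, X.IsCurve γ → ∀ v : Hyp ξ, (v : Euc (n + 1)) = deriv γ 0 →
    β.1 v v = ξ (iteratedDeriv 2 γ 0)

/-- `β` is the second fundamental form of the 2-jet `a` with respect to `ξ`. -/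
def IsSFF {n : ℕ} (a : Jet n 2) (ξ : Covector n) (β : SymBil (Hyp ξ)) : Prop :=
  ∃ X : PointedHypersurface n, jet 2 X = a ∧ X.IsSFF ξ β

/-- The shape operator `A = g⁻¹ ∘ β`, that is `⟨A v, w⟩ = β(v, w)`. -/
def shapeOperator {n : ℕ} {ξ : Covector n} (β : SymBil (Hyp ξ)) : Hyp ξ →ₗ[ℝ] Hyp ξ :=
  { toFun := fun v => (InnerProductSpace.toDual ℝ (Hyp ξ)).symm (β.1 v)
    map_add' := fun v w => by rw [map_add, map_add]
    map_smul' := fun r v => by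
      rw [map_smul, map_smulₛₗ]
      rfl }

/-- The principal curvatures `k₁, …, kₙ`: the eigenvalues of the shape operator, with
multiplicity. -/
def principalCurvatures {n : ℕ} {ξ : Covector n} (β : SymBil (Hyp ξ)) : Multiset ℝ :=
  (shapeOperator β).charpoly.roots

/-- The elementary symmetric functions `(σ₁, …, σₙ)` of the principal curvatures. -/
def sigma {n : ℕ} {ξ : Covector n} (β : SymBil (Hyp ξ)) : Fin n → ℝ :=
  fun k => (principalCurvatures β).esymm (k + 1)

/-- `SO(V)`-invariance of a function on `S²V*`, `V = ker ξ`. -/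
def IsSOInvariant {n : ℕ} {ξ : Covector n} (F : SymBil (Hyp ξ) → ℝ) : Prop :=
  ∀ A : Hyp ξ ≃ₗᵢ[ℝ] Hyp ξ, LinearMap.det (A.toLinearEquiv : Hyp ξ →ₗ[ℝ] Hyp ξ) = 1 →
    ∀ β β' : SymBil (Hyp ξ),
      (∀ v w, β'.1 v w = β.1 (A v) (A w)) → F β' = F β

/-! ### Cooriented jets -/

/-- Cooriented 2-jets: 2-jets of hypersurfaces with a choice of one of the two unit conormals
(equivalently, of the unit normals) of the tangent hyperplane. -/
structure CoJet (n : ℕ) where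
  jet : Jet n 2
  conormal : Covector n
  isUnitConormal : IsUnitConormal jet.proj conormal

/-- A motion acts on covectors by `ξ ↦ ξ ∘ (dg)⁻¹`. -/
def moveCovector {n : ℕ} (g : Isom n) (ξ : Covector n) : Covector n :=
  ξ.comp (g.linearIsometryEquiv.symm.toContinuousLinearEquiv :
    Euc (n + 1) →L[ℝ] Euc (n + 1))

lemma norm_moveCovector {n : ℕ} (g : Isom n) (ξ : Covector n) : ‖moveCovector g ξ‖ = ‖ξ‖ :=
  ContinuousLinearMap.opNorm_comp_linearIsometryEquiv ξ g.linearIsometryEquiv.symm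

lemma Jet.proj_move {n : ℕ} (g : Isom n) (a : Jet n 2) :
    (a.move g).proj = a.proj.move g := by
  induction a using Quot.ind
  rfl

lemma isCurve_of_move {n : ℕ} {g : Isom n} {X : PointedHypersurface n} {γ : ℝ → Euc (n + 1)}
    (h : (X.move g).IsCurve γ) : X.IsCurve (fun t => g.symm (γ t)) := by
  obtain ⟨h1, h2, h3⟩ := h
  have hg : ContDiff ℝ ∞ (fun q => g.symm q) :=
    ContinuousAffineMap.contDiff
      ({ g.symm.toAffineEquiv.toAffineMap with cont := g.symm.continuous } :
        Euc (n + 1) →ᴬ[ℝ] Euc (n + 1))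
  refine ⟨hg.comp h1, ?_, ?_⟩
  · show g.symm (γ 0) = X.p
    rw [h2]
    exact g.symm_apply_apply X.p
  · filter_upwards [h3] with t ht
    obtain ⟨y, hy, e⟩ := ht
    rw [← e, g.symm_apply_apply]
    exact hy

lemma deriv_isom_comp {n : ℕ} (g : Isom n) {γ : ℝ → Euc (n + 1)} (h : ContDiff ℝ ∞ γ) (t : ℝ) :
    deriv (fun s => g (γ s)) t = g.linearIsometryEquiv (deriv γ t) := by
  have e : (fun s => g (γ s)) = fun s => g.linearIsometryEquiv (γ s) + g 0 := by
    funext s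
    have := g.map_vadd 0 (γ s)
    simpa using this
  have hd : HasDerivAt γ (deriv γ t) t :=
    ((h.differentiable (by simp)) t).hasDerivAt
  have h2 := (g.linearIsometryEquiv.toContinuousLinearEquiv.toContinuousLinearMap.hasFDerivAt
    (x := γ t)).comp_hasDerivAt t hd
  rw [e]
  exact (h2.add_const (g 0)).deriv

lemma IsUnitConormal.move {n : ℕ} {a : Jet n 1} {ξ : Covector n} (h : IsUnitConormal a ξ)
    (g : Isom n) : IsUnitConormal (a.move g) (moveCovector g ξ) := by
  obtain ⟨⟨X, rfl, hξ, hX⟩, hn⟩ := h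
  have hn' : ‖moveCovector g ξ‖ = 1 := by rw [norm_moveCovector, hn]
  refine ⟨⟨X.move g, rfl, ?_, ?_⟩, hn'⟩
  · intro h0
    rw [h0, norm_zero] at hn'
    exact zero_ne_one hn'
  · intro γ hγ
    have := hX _ (isCurve_of_move hγ)
    rw [deriv_isom_comp g.symm hγ.1] at this
    exact this

/-- The action of motions on cooriented 2-jets. -/
def CoJet.move {n : ℕ} (g : Isom n) (a : CoJet n) : CoJet n where
  jet := a.jet.move g
  conormal := moveCovector g a.conormal
  isUnitConormal := by
    rw [Jet.proj_move]
    exact a.isUnitConormal.move g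

/-! ### Jet coordinates, smooth functions and PDEs -/

/-- The values of the jet coordinates `(u, x, (u_i), (u_{ij}))`. -/
abbrev JetCoord (n : ℕ) := ℝ × Euc n × (Euc n →L[ℝ] ℝ) × SymBil (Euc n)

/-- The quadratic polynomial with the 2-jet at `x = z.2.1` prescribed by `z`. -/
def taylor {n : ℕ} (z : JetCoord n) (y : Euc n) : ℝ :=
  z.1 + z.2.2.1 (y - z.2.1) +
    (1 / 2) * z.2.2.2.1 (y - z.2.1) (y - z.2.1)

lemma contDiff_taylor {n : ℕ} (z : JetCoord n) : ContDiff ℝ ∞ (taylor z) := by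
  unfold taylor
  have hs : ContDiff ℝ ∞ (fun y : Euc n => y - z.2.1) := contDiff_id.sub contDiff_const
  have hB : ContDiff ℝ ∞ (fun y : Euc n =>
      z.2.2.2.1 (y - z.2.1) (y - z.2.1)) :=
    ((ContinuousLinearMap.contDiff _).comp hs).clm_apply hs
  exact (contDiff_const.add ((ContinuousLinearMap.contDiff _).comp hs)).add
    (contDiff_const.mul hB)

/-- The graph of the polynomial `taylor z` in the Euclidean coordinates `c`, marked at the point
over `x = z.2.1`. -/
def graphOf {n : ℕ} (c : Isom n) (z : JetCoord n) : PointedHypersurface n where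
  S := {q | ucoord c q = taylor z (xcoord c q)}
  p := c.symm (join z.1 z.2.1)
  isHypersurface := fun _ _ =>
    ⟨c, taylor z, contDiff_taylor z, Filter.Eventually.of_forall fun _ => Iff.rfl⟩
  mem := by
    have hx : xcoord c (c.symm (join z.1 z.2.1)) = z.2.1 := by
      unfold xcoord
      rw [c.apply_symm_apply]
      ext i
      simp [tail, join]
    have hu : ucoord c (c.symm (join z.1 z.2.1)) = z.1 := by
      unfold ucoord
      rw [c.apply_symm_apply]
      simp [join]
    show ucoord c _ = taylor z (xcoord c _)
    rw [hx, hu]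
    simp [taylor]

/-- The 2-jet with jet coordinates `z` with respect to `c`. For fixed `c` this is the inverse of
a chart of `J²`, defined on the 2-jets of hypersurfaces transversal to `∂_u`; these charts
cover `J²`. -/
def jetWithCoord {n : ℕ} (c : Isom n) (z : JetCoord n) : Jet n 2 := jet 2 (graphOf c z)

/-- `a ∈ J²` has jet coordinates `z` with respect to `c`. -/
def Jet.HasCoord {n : ℕ} (c : Isom n) (z : JetCoord n) (a : Jet n 2) : Prop :=
  a = jetWithCoord c z

/-- The cooriented 2-jet `a` has jet coordinates `z` with respect to `c`, where the chart
consists of the cooriented jets whose coorientation is upward, `ξ(∂_u) > 0`. -/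
def CoJet.HasCoord {n : ℕ} (c : Isom n) (z : JetCoord n) (a : CoJet n) : Prop :=
  a.jet = jetWithCoord c z ∧ 0 < a.conormal (c.linearIsometryEquiv.symm (join 1 0))

/-- Closed smooth (embedded) hypersurfaces of a normed space. -/
def IsClosedHypersurface {W : Type*} [NormedAddCommGroup W] [NormedSpace ℝ W]
    (Z : Set W) : Prop :=
  IsClosed Z ∧ ∀ w ∈ Z, ∃ f : W → ℝ, ContDiff ℝ ∞ f ∧ fderiv ℝ f w ≠ 0 ∧
    ∀ᶠ z in 𝓝 w, (z ∈ Z ↔ f z = 0)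

/-- `E` is a closed smooth hypersurface of the space `T` of (cooriented) 2-jets, whose charts are
given by `R`. -/
def IsJetHypersurface {n : ℕ} {T : Type} (R : Isom n → JetCoord n → T → Prop)
    (E : Set T) : Prop :=
  ∀ c : Isom n, IsClosedHypersurface {z | ∃ a ∈ E, R c z a}

/-- `E` is a scalar second-order PDE, that is, a closed smooth hypersurface of the space `T` of
(cooriented) 2-jets which is fibred over the 1-jets: its local equations can be chosen with
nonzero derivative in the direction of the second-order coordinates `u_{ij}`. -/
def IsSecondOrderPDE {n : ℕ} {T : Type} (R : Isom n → JetCoord n → T → Prop)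
    (E : Set T) : Prop :=
  ∀ c : Isom n, IsClosed {z | ∃ a ∈ E, R c z a} ∧
    ∀ w ∈ {z | ∃ a ∈ E, R c z a}, ∃ f : JetCoord n → ℝ, ContDiff ℝ ∞ f ∧
      (∃ b : SymBil (Euc n), fderiv ℝ f w (0, 0, 0, b) ≠ 0) ∧
      ∀ᶠ z in 𝓝 w, (z ∈ {z | ∃ a ∈ E, R c z a} ↔ f z = 0)

/-- Smooth functions on the space `T` of (cooriented) 2-jets. -/
def IsSmoothOnJets {n : ℕ} {T : Type} (R : Isom n → JetCoord n → T → Prop)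
    (Fhat : T → ℝ) : Prop :=
  ∀ c : Isom n, ∃ f : JetCoord n → ℝ, ContDiff ℝ ∞ f ∧ ∀ z a, R c z a → Fhat a = f z

/-- `SE(n+1)`-invariance of a set of 2-jets. -/
def IsInvariantSet {n : ℕ} {T : Type} (act : Isom n → T → T) (E : Set T) : Prop :=
  ∀ g ∈ SE n, ∀ a ∈ E, act g a ∈ E

/-- `SE(n+1)`-invariance of a function on 2-jets. -/
def IsInvariantFun {n : ℕ} {T : Type} (act : Isom n → T → T) (Fhat : T → ℝ) : Prop :=
  ∀ g ∈ SE n, ∀ a, Fhat (act g a) = Fhat a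

/-- The fibre `π_{2,1}⁻¹(a₁)` of `J² → J¹`. -/
abbrev Fibre {n : ℕ} (a₁ : Jet n 1) := {a : Jet n 2 // a.proj = a₁}

/-- `Fhat` is an `SE(n+1)`-invariant function on cooriented 2-jets which extends the function `F`
on `S²V*`, where `ι` identifies the fibre over the cooriented 1-jet `(a₁, ξ)` with `S²V*`. -/
def IsCoExtension {n : ℕ} {a₁ : Jet n 1} {ξ : Covector n} (ι : Fibre a₁ ≃ SymBil (Hyp ξ))
    (F : SymBil (Hyp ξ) → ℝ) (Fhat : CoJet n → ℝ) : Prop :=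
  IsInvariantFun CoJet.move Fhat ∧
    ∀ (a : CoJet n) (h : a.jet.proj = a₁), a.conormal = ξ → Fhat a = F (ι ⟨a.jet, h⟩)

/-- `Fhat` is an `SE(n+1)`-invariant function on `J²` which extends the function `F` on `S²V*`,
where `ι` identifies the fibre over `a₁` with `S²V*`. -/
def IsExtension {n : ℕ} {a₁ : Jet n 1} {ξ : Covector n} (ι : Fibre a₁ ≃ SymBil (Hyp ξ))
    (F : SymBil (Hyp ξ) → ℝ) (Fhat : Jet n 2 → ℝ) : Prop :=
  IsInvariantFun Jet.move Fhat ∧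
    ∀ (a : Jet n 2) (h : a.proj = a₁), Fhat a = F (ι ⟨a, h⟩)

end EuclideanJets

end

open EuclideanJets

open EuclideanJets

noncomputable section

namespace EuclideanJets

/-! ### Symmetric bilinear forms on Euclidean vector spaces and their invariants -/

section Forms

variable {W W' W'' : Type*} [NormedAddCommGroup W] [InnerProductSpace ℝ W]
  [FiniteDimensional ℝ W] [NormedAddCommGroup W'] [InnerProductSpace ℝ W']
  [FiniteDimensional ℝ W'] [NormedAddCommGroup W''] [InnerProductSpace ℝ W'']
  [FiniteDimensional ℝ W'']

/-! Everything rests on two facts: a cooriented 2-jet is determined by its base point, unit conormal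
and second fundamental form, and its `SE(n+1)`-orbit is determined by the elementary symmetric
functions of its principal curvatures.

For the first, let a curve `γ` lie in a graph `u = f(x)` and let `ξ` be a conormal. Then `ξ`
composed with the graph map has a critical point at the marked point, so `ξ(γ'')` is the Hessian of
`f` on the projected velocity times `ξ(∂_u)` (`IsGraphAt.iteratedDeriv_curve`). Hence the second
fundamental form exists, is linear in the `u_{ij}`, and together with point and conormal fixes the
2-jet (`Jet.ext_two`).

For the second, the functions `σ₁, …, σₙ` are the coefficients, up to sign, of a characteristic
polynomial with real roots, and the spectral theorem makes forms with equal `σ` isometric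
(`exists_pullback_of_sigmaOf_eq`). An isometry of determinant `-1` is corrected by a reflection in
an eigenvector, which preserves the form; this needs `1 ≤ n`. So `SO(V)`-invariants are functions of
`σ` (`isSOInvariant_iff`), and the invariants separate orbits (`CoJet.exists_move_eq`), which gives
existence and uniqueness of the extension.

In a chart, the form of a graph written in an orthonormal frame is `normalForm`, which is smooth and
restricts to a linear isomorphism on each fibre. An equation in normal forms therefore pulls back to
a hypersurface transversal to the fibres (`isSecondOrderPDE_of_normalForm`). Conversely, an
invariant hypersurface is a preimage `normalForm ⁻¹' Z`, and slicing shows that `Z` is a closed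
hypersurface (`isClosedHypersurface_of_normalForm`). On diagonal forms `σ` is proper by Cauchy's
root bound, so `σ(Z)` is closed and is the zero set of a smooth `Φ`
(`exists_contDiff_zeroSet_sigmaOf`).

Reversing the coorientation negates the form and changes `σ_k` by `(-1)^k`. Without coorientation
exactly the even functions extend, and `Φ` is made even by a sum of two squares
(`exists_smooth_even_equation`). -/

lemma SymBil.ext_apply {β β' : SymBil W} (h : ∀ v w, β.1 v w = β'.1 v w) : β = β' := by
  apply Subtype.ext
  ext v w
  exact h v w

/-- A symmetric bilinear form is determined by its quadratic form. -/
lemma SymBil.ext_diag {β β' : SymBil W} (h : ∀ v, β.1 v v = β'.1 v v) : β = β' := by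
  refine SymBil.ext_apply fun v w => ?_
  have h1 := h (v + w)
  have h2 := β.2 v w
  have h3 := β'.2 v w
  simp only [map_add, add_apply] at h1
  linarith [h v, h w]

/-- The pullback of symmetric bilinear forms along a linear map. -/
def pullback (B : W →L[ℝ] W') : SymBil W' →L[ℝ] SymBil W :=
  LinearMap.toContinuousLinearMap
    { toFun := fun β => ⟨β.1.bilinearComp B B, fun _ _ => β.2 _ _⟩
      map_add' := fun _ _ => rfl
      map_smul' := fun _ _ => rfl }

@[simp] lemma pullback_apply (B : W →L[ℝ] W') (β : SymBil W') (v w : W) :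
    (pullback B β).1 v w = β.1 (B v) (B w) := rfl

/-- The pullback along a linear equivalence, as an equivalence. -/
def pullbackEquiv (B : W ≃L[ℝ] W') : SymBil W' ≃L[ℝ] SymBil W :=
  ContinuousLinearEquiv.equivOfInverse (pullback (B : W →L[ℝ] W'))
    (pullback (B.symm : W' →L[ℝ] W))
    (fun β => SymBil.ext_apply fun v w => by simp)
    (fun β => SymBil.ext_apply fun v w => by simp)

@[simp] lemma pullbackEquiv_apply (B : W ≃L[ℝ] W') (β : SymBil W') (v w : W) :
    (pullbackEquiv B β).1 v w = β.1 (B v) (B w) := rfl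

/-- The operator `A` with `⟨A v, w⟩ = β(v, w)`. -/
def shapeOp (β : SymBil W) : W →ₗ[ℝ] W :=
  { toFun := fun v => (InnerProductSpace.toDual ℝ W).symm (β.1 v)
    map_add' := fun v w => by rw [map_add, map_add]
    map_smul' := fun r v => by
      rw [map_smul, map_smulₛₗ]
      rfl }

lemma inner_shapeOp (β : SymBil W) (v w : W) : inner ℝ (shapeOp β v) w = β.1 v w :=
  InnerProductSpace.toDual_symm_apply

lemma shapeOp_eq_of_inner (β : SymBil W) (A : W →ₗ[ℝ] W)
    (h : ∀ v w, inner ℝ (A v) w = β.1 v w) : shapeOp β = A := by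
  ext v
  refine ext_inner_right ℝ fun w => ?_
  rw [inner_shapeOp, h]

lemma shapeOp_isSymmetric (β : SymBil W) : (shapeOp β).IsSymmetric := fun v w => by
  rw [inner_shapeOp, real_inner_comm, inner_shapeOp]
  exact β.2 _ _

/-- The first `n` elementary symmetric functions of the eigenvalues of a symmetric form. -/
def sigmaOf (n : ℕ) (β : SymBil W) : Fin n → ℝ :=
  fun k => (shapeOp β).charpoly.roots.esymm (k + 1)

lemma sigma_eq_sigmaOf {n : ℕ} {ξ : Covector n} (β : SymBil (Hyp ξ)) :
    sigma β = sigmaOf n β := rfl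

/-- Pulling back by an isometry conjugates the shape operator, and conjugate operators have the same
characteristic polynomial. -/
lemma sigmaOf_pullback (n : ℕ) (B : W ≃ₗᵢ[ℝ] W') (β : SymBil W') :
    sigmaOf n (pullbackEquiv B.toContinuousLinearEquiv β) = sigmaOf n β := by
  have h : shapeOp (pullbackEquiv B.toContinuousLinearEquiv β) =
      B.symm.toLinearEquiv.conj (shapeOp β) := by
    refine shapeOp_eq_of_inner _ _ fun v w => ?_
    rw [LinearEquiv.conj_apply]
    show inner ℝ (B.symm (shapeOp β (B v))) w = β.1 (B v) (B w)
    rw [← inner_shapeOp, ← LinearIsometryEquiv.inner_map_map B, B.apply_symm_apply]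
  unfold sigmaOf
  rw [h, LinearEquiv.charpoly_conj]

/-- The characteristic polynomial of a symmetric operator splits over `ℝ`, so each coefficient is,
up to sign, an elementary symmetric function of its roots. -/
lemma charpoly_eq_of_sigmaOf_eq {n : ℕ} (hW : Module.finrank ℝ W = n)
    (hW' : Module.finrank ℝ W' = n) {β : SymBil W} {β' : SymBil W'}
    (h : sigmaOf n β = sigmaOf n β') : (shapeOp β).charpoly = (shapeOp β').charpoly := by
  have d : (shapeOp β).charpoly.natDegree = n := by rw [LinearMap.charpoly_natDegree, hW]
  have d' : (shapeOp β').charpoly.natDegree = n := by rw [LinearMap.charpoly_natDegree, hW']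
  ext k
  rcases le_or_gt k n with hk | hk
  · rw [Polynomial.coeff_eq_esymm_roots_of_splits (shapeOp_isSymmetric β).splits_charpoly
      (by rw [d]; exact hk), Polynomial.coeff_eq_esymm_roots_of_splits
      (shapeOp_isSymmetric β').splits_charpoly (by rw [d']; exact hk), d, d',
      (LinearMap.charpoly_monic _).leadingCoeff, (LinearMap.charpoly_monic _).leadingCoeff]
    congr 1
    -- The leading coefficient corresponds to `σ₀ = 1`, which `sigmaOf` omits; the coefficient of
    -- degree `k < n` involves `σ_{n-k}`, stored at index `n - k - 1`.
    rcases hk.eq_or_lt with rfl | hk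
    · simp [Multiset.esymm]
    · have := congrFun h ⟨n - k - 1, by omega⟩
      simpa [sigmaOf, show n - k - 1 + 1 = n - k by omega] using this
  · rw [Polynomial.coeff_eq_zero_of_natDegree_lt (by omega),
      Polynomial.coeff_eq_zero_of_natDegree_lt (by omega)]

/-- Symmetric forms with the same invariants are isometric. -/
lemma exists_pullback_of_sigmaOf_eq {n : ℕ} (hW : Module.finrank ℝ W = n)
    (hW' : Module.finrank ℝ W' = n) {β : SymBil W} {β' : SymBil W'}
    (h : sigmaOf n β = sigmaOf n β') :
    ∃ B : W ≃ₗᵢ[ℝ] W', pullbackEquiv B.toContinuousLinearEquiv β' = β := by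
  have hs := shapeOp_isSymmetric β
  have hs' := shapeOp_isSymmetric β'
  -- Equal characteristic polynomials give equal eigenvalue lists in the same order, so matching the
  -- two eigenbases index by index intertwines the operators.
  have he := (hs.eigenvalues_eq_eigenvalues_iff hW hs' hW').2
    (charpoly_eq_of_sigmaOf_eq hW hW' h)
  set B := (hs.eigenvectorBasis hW).repr.trans (hs'.eigenvectorBasis hW').repr.symm with hB
  have key : ∀ v, B (shapeOp β v) = shapeOp β' (B v) := by
    intro v
    apply (hs'.eigenvectorBasis hW').repr.injective
    ext i
    rw [hs'.eigenvectorBasis_apply_self_apply]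
    simp [hB, hs.eigenvectorBasis_apply_self_apply, he]
  refine ⟨B, SymBil.ext_apply fun v w => ?_⟩
  show β'.1 (B v) (B w) = _
  rw [← inner_shapeOp, ← key, B.inner_map_map, inner_shapeOp]

lemma det_eq_one_or_neg_one (B : W ≃ₗᵢ[ℝ] W) :
    LinearMap.det (B.toLinearEquiv : W →ₗ[ℝ] W) = 1 ∨
      LinearMap.det (B.toLinearEquiv : W →ₗ[ℝ] W) = -1 := by
  have a := stdOrthonormalBasis ℝ W
  have h := a.det_to_matrix_orthonormalBasis_real (a.map B)
  have h2 := a.toBasis.det_comp (B.toLinearEquiv : W →ₗ[ℝ] W) a.toBasis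
  rw [Module.Basis.det_self, mul_one] at h2
  rw [← h2]
  exact h

lemma reflection_orthogonal_unit_apply {e : W} (he : ‖e‖ = 1) (v : W) :
    (ℝ ∙ e)ᗮ.reflection v = v - (2 * inner ℝ e v) • e := by
  rw [Submodule.reflection_orthogonal_apply, Submodule.reflection_singleton_apply, he]
  simp [two_smul, two_mul, add_smul]

lemma det_reflection_orthogonal_unit {e : W} (he : ‖e‖ = 1) :
    LinearMap.det ((ℝ ∙ e)ᗮ.reflection.toLinearEquiv : W →ₗ[ℝ] W) = -1 := by
  have hne : e ≠ 0 := by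
    rintro rfl
    simp at he
  have := (ℝ ∙ e)ᗮ.det_reflection
  rw [Submodule.orthogonal_orthogonal, finrank_span_singleton hne, pow_one] at this
  exact this

lemma exists_eigenvector (hW : 1 ≤ Module.finrank ℝ W) (β : SymBil W) :
    ∃ (e : W) (μ : ℝ), ‖e‖ = 1 ∧ ∀ w, β.1 e w = μ * inner ℝ e w := by
  have hs := shapeOp_isSymmetric β
  refine ⟨hs.eigenvectorBasis rfl ⟨0, hW⟩, hs.eigenvalues rfl ⟨0, hW⟩,
    (hs.eigenvectorBasis rfl).orthonormal.1 _, fun w => ?_⟩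
  rw [← inner_shapeOp, hs.apply_eigenvectorBasis, real_inner_smul_left]
  rfl

/-- A symmetric form is preserved by the reflection in the direction of an eigenvector. -/
lemma apply_reflect_eigenvector {β : SymBil W} {e : W} {μ : ℝ} (he : ‖e‖ = 1)
    (hμ : ∀ w, β.1 e w = μ * inner ℝ e w) (v w : W) :
    β.1 (v - (2 * inner ℝ e v) • e) (w - (2 * inner ℝ e w) • e) = β.1 v w := by
  have hee : inner ℝ e e = (1 : ℝ) := by rw [real_inner_self_eq_norm_sq, he]; norm_num
  simp only [map_sub, map_smul, sub_apply, smul_apply, smul_eq_mul, β.2 v e, hμ, hee]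
  ring

end Forms

/-! ### Diagonal forms -/

/-- The form on `ℝⁿ` with matrix `diag(l₁, …, lₙ)`. -/
def diagForm {n : ℕ} : (Fin n → ℝ) →ₗ[ℝ] SymBil (Euc n) where
  toFun l := ⟨∑ i, l i • ((EuclideanSpace.proj i : Euc n →L[ℝ] ℝ).smulRight
      (EuclideanSpace.proj i : Euc n →L[ℝ] ℝ)), fun v w => by simp [mul_comm]⟩
  map_add' a b := by
    apply Subtype.ext
    simp [add_smul, Finset.sum_add_distrib]
  map_smul' r a := by
    apply Subtype.ext
    simp [mul_smul, Finset.smul_sum]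

lemma diagForm_apply {n : ℕ} (l : Fin n → ℝ) (v w : Euc n) :
    (diagForm l).1 v w = ∑ i, l i * (v i * w i) := by
  simp [diagForm]

lemma charpoly_shapeOp_diagForm {n : ℕ} (l : Fin n → ℝ) :
    (shapeOp (diagForm l)).charpoly = ∏ i, (Polynomial.X - Polynomial.C (l i)) := by
  rw [shapeOp_eq_of_inner _ (Matrix.toLin (EuclideanSpace.basisFun (Fin n) ℝ).toBasis
    (EuclideanSpace.basisFun (Fin n) ℝ).toBasis (Matrix.diagonal l)),
    LinearMap.charpoly_def, ← LinearMap.charpoly_def, ← LinearMap.charpoly_toMatrix _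
    (EuclideanSpace.basisFun (Fin n) ℝ).toBasis, LinearMap.toMatrix_toLin,
    Matrix.charpoly_diagonal]
  intro v w
  rw [diagForm_apply, Matrix.toLin_apply]
  simp only [PiLp.inner_apply, Matrix.mulVec_diagonal, WithLp.ofLp_sum, Finset.sum_apply,
    WithLp.ofLp_smul, Pi.smul_apply, OrthonormalBasis.coe_toBasis, EuclideanSpace.basisFun_apply,
    OrthonormalBasis.coe_toBasis_repr_apply, EuclideanSpace.basisFun_repr]
  simp
  exact Finset.sum_congr rfl fun i _ => by ring

lemma sigmaOf_diagForm {n : ℕ} (l : Fin n → ℝ) (k : Fin n) :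
    sigmaOf n (diagForm l) k = (Finset.univ.val.map l).esymm (k + 1) := by
  unfold sigmaOf
  have h := Polynomial.roots_multiset_prod_X_sub_C (Finset.univ.val.map l)
  rw [Multiset.map_map] at h
  rw [charpoly_shapeOp_diagForm, ← h]
  rfl

/-- The spectral theorem: the isometry is given by coordinates in an orthonormal eigenbasis. -/
lemma exists_diagForm {n : ℕ} {W : Type*} [NormedAddCommGroup W] [InnerProductSpace ℝ W]
    [FiniteDimensional ℝ W] (hW : Module.finrank ℝ W = n) (β : SymBil W) :
    ∃ (l : Fin n → ℝ) (B : W ≃ₗᵢ[ℝ] Euc n),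
      pullbackEquiv B.toContinuousLinearEquiv (diagForm l) = β := by
  have hs := shapeOp_isSymmetric β
  refine ⟨hs.eigenvalues hW, (hs.eigenvectorBasis hW).repr, SymBil.ext_apply fun v w => ?_⟩
  rw [pullbackEquiv_apply, diagForm_apply, ← inner_shapeOp,
    ← (hs.eigenvectorBasis hW).repr.inner_map_map, PiLp.inner_apply]
  refine Finset.sum_congr rfl fun i _ => ?_
  rw [hs.eigenvectorBasis_apply_self_apply]
  simp
  ring

/-- The effect of `β ↦ -β` on the elementary symmetric functions. -/
def signFlip {n : ℕ} (s : Fin n → ℝ) : Fin n → ℝ := fun k => (-1) ^ ((k : ℕ) + 1) * s k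

/-- On a diagonal form every eigenvalue changes sign, and the `k`-th elementary symmetric function
is homogeneous of degree `k`. -/
lemma sigmaOf_neg {n : ℕ} {W : Type*} [NormedAddCommGroup W] [InnerProductSpace ℝ W]
    [FiniteDimensional ℝ W] (hW : Module.finrank ℝ W = n) (β : SymBil W) :
    sigmaOf n (-β) = signFlip (sigmaOf n β) := by
  obtain ⟨l, B, rfl⟩ := exists_diagForm hW β
  rw [← map_neg, ← map_neg, sigmaOf_pullback, sigmaOf_pullback]
  funext k
  rw [signFlip, sigmaOf_diagForm, sigmaOf_diagForm, ← Multiset.esymm_neg, Multiset.map_map]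
  rfl

/-! ### Properness of the invariants on diagonal forms. -/

lemma continuous_sigmaOf_diagForm {n : ℕ} :
    Continuous fun l : Fin n → ℝ => sigmaOf n (diagForm l) := by
  refine continuous_pi fun k => ?_
  simp only [sigmaOf_diagForm, Finset.esymm_map_val]
  fun_prop

/-- Cauchy's bound: a root of a monic polynomial is smaller in absolute value than one plus the
largest absolute value of the lower coefficients. Here the roots are the diagonal entries and the
coefficients are `±σ_k`. -/
lemma norm_le_norm_sigmaOf_diagForm {n : ℕ} (l : Fin n → ℝ) :
    ‖l‖ - 1 ≤ ‖sigmaOf n (diagForm l)‖ := by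
  rw [sub_le_iff_le_add, pi_norm_le_iff_of_nonneg (by positivity)]
  intro i
  set p := ∏ i, (Polynomial.X - Polynomial.C (l i)) with hp
  have hmon : p.Monic := Polynomial.monic_prod_X_sub_C _ _
  have hdeg : p.natDegree = n := by simp [hp]
  have hroot : p.IsRoot (l i) := by
    simp only [Polynomial.IsRoot, hp, Polynomial.eval_prod]
    exact Finset.prod_eq_zero (Finset.mem_univ i) (by simp)
  have h1 := hroot.norm_lt_cauchyBound hmon.ne_zero
  have h2 : p.cauchyBound ≤ ‖sigmaOf n (diagForm l)‖₊ + 1 := by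
    rw [Polynomial.cauchyBound, hmon.leadingCoeff, nnnorm_one, div_one]
    gcongr
    refine Finset.sup_le fun k hk => ?_
    rw [hdeg, Finset.mem_range] at hk
    have hs : p.Splits := by
      rw [hp, ← charpoly_shapeOp_diagForm]
      exact (shapeOp_isSymmetric _).splits_charpoly
    rw [Polynomial.coeff_eq_esymm_roots_of_splits hs (by omega), hmon.leadingCoeff, hdeg]
    have h3 : p.roots.esymm (n - k) = sigmaOf n (diagForm l) ⟨n - k - 1, by omega⟩ := by
      simp [sigmaOf, charpoly_shapeOp_diagForm, hp, show n - k - 1 + 1 = n - k by omega]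
    rw [h3]
    simpa using nnnorm_le_pi_nnnorm (sigmaOf n (diagForm l)) ⟨n - k - 1, by omega⟩
  exact_mod_cast (h1.trans_le h2).le

/-- By the previous bound the invariants tend to infinity with the diagonal entries, so the map is
proper. -/
lemma isClosedMap_sigmaOf_diagForm {n : ℕ} :
    IsClosedMap fun l : Fin n → ℝ => sigmaOf n (diagForm l) := by
  refine IsProperMap.isClosedMap
    (isProperMap_iff_tendsto_cocompact.2 ⟨continuous_sigmaOf_diagForm, ?_⟩)
  rw [← Metric.cobounded_eq_cocompact,
    ← tendsto_norm_atTop_iff_cobounded]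
  refine Filter.tendsto_atTop_mono norm_le_norm_sigmaOf_diagForm ?_
  exact Filter.tendsto_atTop_add_const_right _ (-1) tendsto_norm_cobounded_atTop

/-- A closed set of symmetric forms which is a union of level sets of the invariants is the zero
set of a smooth function of the invariants. -/
lemma exists_contDiff_zeroSet_sigmaOf {n : ℕ} {Z : Set (SymBil (Euc n))} (hZ : IsClosed Z)
    (hsat : ∀ β ∈ Z, ∀ β', sigmaOf n β' = sigmaOf n β → β' ∈ Z) :
    ∃ Φ : (Fin n → ℝ) → ℝ, ContDiff ℝ ∞ Φ ∧ ∀ β, Φ (sigmaOf n β) = 0 ↔ β ∈ Z := by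
  have hcl : IsClosed ((fun l : Fin n → ℝ => sigmaOf n (diagForm l)) '' (diagForm ⁻¹' Z)) :=
    isClosedMap_sigmaOf_diagForm _
      (hZ.preimage (LinearMap.continuous_of_finiteDimensional diagForm))
  -- Any open set is the support of a smooth function; the complement of the closed image gives `Φ`
  -- vanishing exactly on that image.
  obtain ⟨Φ, hΦ, hΦs, -⟩ := hcl.isOpen_compl.exists_contDiff_support_eq (n := ⊤)
  refine ⟨Φ, hΦs, fun β => ?_⟩
  have h0 : Φ (sigmaOf n β) = 0 ↔ sigmaOf n β ∉ Function.support Φ := by simp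
  rw [h0, hΦ, Set.notMem_compl_iff]
  constructor
  · rintro ⟨l, hl, h⟩
    exact hsat _ hl _ h.symm
  · intro hβ
    obtain ⟨l, B, rfl⟩ := exists_diagForm finrank_euclideanSpace_fin β
    refine ⟨l, hsat _ hβ _ ?_, ?_⟩ <;> simp only [sigmaOf_pullback]

lemma finrank_hyp {n : ℕ} {ξ : Covector n} (hξ : ξ ≠ 0) : Module.finrank ℝ (Hyp ξ) = n := by
  have h := Module.Dual.finrank_ker_add_one_of_ne_zero
    (f := (ξ : Euc (n + 1) →ₗ[ℝ] ℝ)) (fun h => hξ (by ext v; exact LinearMap.congr_fun h v))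
  rw [finrank_euclideanSpace_fin] at h
  exact Nat.succ_injective h

/-- `SO(V)`-invariant functions are the functions of the elementary symmetric functions. -/
lemma isSOInvariant_iff {n : ℕ} (hn : 1 ≤ n) {ξ : Covector n} (hξ : ξ ≠ 0)
    (F : SymBil (Hyp ξ) → ℝ) :
    IsSOInvariant F ↔ ∃ Φ : (Fin n → ℝ) → ℝ, ∀ β, F β = Φ (sigma β) := by
  constructor
  · intro hF
    have key : ∀ β β' : SymBil (Hyp ξ), sigma β = sigma β' → F β = F β' := by
      intro β β' h
      obtain ⟨B, hB⟩ := exists_pullback_of_sigmaOf_eq (finrank_hyp hξ) (finrank_hyp hξ) h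
      by_cases hdet : LinearMap.det (B.toLinearEquiv : Hyp ξ →ₗ[ℝ] Hyp ξ) = 1
      · exact hF B hdet β' β fun v w => by rw [← hB]; rfl
      -- If `B` reverses orientation, composing it with the reflection in an eigenvector of `β`
      -- makes the determinant `1` without affecting the pulled-back form.
      · obtain ⟨e, μ, he, hμ⟩ := exists_eigenvector (by rw [finrank_hyp hξ]; exact hn) β
        have hdet' : LinearMap.det (B.toLinearEquiv : Hyp ξ →ₗ[ℝ] Hyp ξ) = -1 :=
          (det_eq_one_or_neg_one B).resolve_left hdet
        refine hF ((ℝ ∙ e)ᗮ.reflection.trans B) ?_ β' β fun v w => ?_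
        · have h1 : (((ℝ ∙ e)ᗮ.reflection.trans B).toLinearEquiv : Hyp ξ →ₗ[ℝ] Hyp ξ) =
            (B.toLinearEquiv : Hyp ξ →ₗ[ℝ] Hyp ξ) ∘ₗ
              ((ℝ ∙ e)ᗮ.reflection.toLinearEquiv : Hyp ξ →ₗ[ℝ] Hyp ξ) := rfl
          rw [h1, LinearMap.det_comp, det_reflection_orthogonal_unit he, hdet']
          norm_num
        · rw [LinearIsometryEquiv.trans_apply, LinearIsometryEquiv.trans_apply,
            reflection_orthogonal_unit_apply he, reflection_orthogonal_unit_apply he,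
            ← apply_reflect_eigenvector he hμ v w]
          conv_lhs => rw [← hB]
          rfl
    -- Not every point of `ℝⁿ` is a value of `sigma`, since the roots must be real; off the range
    -- `Φ` is set to zero.
    refine ⟨Function.extend sigma F 0, fun β => ?_⟩
    exact ((Function.FactorsThrough.extend_apply (fun a b h => key a b h) 0 β)).symm
  · rintro ⟨Φ, hΦ⟩ A - β β' h
    have e : β' = pullbackEquiv A.toContinuousLinearEquiv β := SymBil.ext_apply h
    rw [hΦ, hΦ, sigma_eq_sigmaOf, sigma_eq_sigmaOf, e, sigmaOf_pullback]

/-! ### Smooth implicit functions, globally defined -/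

/-- Multiplication by a bump function supported where `ψ` is smooth. It supplies the globally
defined functions that `IsGraphAt` asks for. -/
lemma exists_contDiff_eventuallyEq {E : Type*} [NormedAddCommGroup E] [InnerProductSpace ℝ E]
    [FiniteDimensional ℝ E] {ψ : E → ℝ} {x : E} (h : ∀ᶠ y in 𝓝 x, ContDiffAt ℝ ∞ ψ y) :
    ∃ f : E → ℝ, ContDiff ℝ ∞ f ∧ ∀ᶠ y in 𝓝 x, f y = ψ y := by
  obtain ⟨r, hr, hb⟩ := Metric.eventually_nhds_iff_ball.1 h
  let χ : ContDiffBump x := ⟨r / 4, r / 2, by positivity, by linarith⟩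
  refine ⟨fun y => χ y * ψ y, contDiff_iff_contDiffAt.2 fun y => ?_, ?_⟩
  · by_cases hy : y ∈ Metric.ball x r
    · exact χ.contDiff.contDiffAt.mul (hb y hy)
    · have hy' : y ∉ tsupport χ := by
        rw [χ.tsupport_eq]
        intro h2
        have : dist y x ≤ r / 2 := h2
        exact hy (by rw [Metric.mem_ball]; linarith)
      have h0 : (fun y => χ y * ψ y) =ᶠ[𝓝 y] fun _ => 0 := by
        filter_upwards [notMem_tsupport_iff_eventuallyEq.1 hy'] with z hz
        rw [hz]
        simp
      exact contDiffAt_const.congr_of_eventuallyEq h0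
  · filter_upwards [χ.eventuallyEq_one] with y hy
    rw [hy]
    simp

lemma exists_contDiff_implicit {E : Type*} [NormedAddCommGroup E] [InnerProductSpace ℝ E]
    [FiniteDimensional ℝ E] {H : E × ℝ → ℝ} (hH : ContDiff ℝ ∞ H) {u : E × ℝ} (h0 : H u = 0)
    (hd : fderiv ℝ H u (0, 1) ≠ 0) :
    ∃ f : E → ℝ, ContDiff ℝ ∞ f ∧ ∀ᶠ v in 𝓝 u, (H v = 0 ↔ v.2 = f v.1) := by
  have hinv : ∀ v, fderiv ℝ H v (0, 1) ≠ 0 →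
      (fderiv ℝ H v ∘L .inr ℝ E ℝ).IsInvertible := by
    intro v hv
    refine ⟨ContinuousLinearEquiv.unitsEquivAut ℝ (Units.mk0 _ hv), ?_⟩
    ext
    simp
  have hc : ∀ v, ContDiffAt ℝ ∞ H v := fun v => hH.contDiffAt
  have hne : (∞ : WithTop ℕ∞) ≠ 0 := by simp
  set ψ := (hc u).implicitFunction hne (hinv u hd) with hψ
  have hψ0 : ψ u.1 = u.2 := (hc u).implicitFunction_apply_self hne (hinv u hd)
  have hiff : ∀ᶠ v in 𝓝 u, (H v = 0 ↔ ψ v.1 = v.2) := by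
    have := (hc u).eventually_apply_eq_iff_implicitFunction hne (hinv u hd)
    rwa [h0] at this
  have hψc : ContinuousAt ψ u.1 :=
    ((hc u).contDiffAt_implicitFunction hne (hinv u hd)).continuousAt
  have hdopen : ∀ᶠ v in 𝓝 u, fderiv ℝ H v (0, 1) ≠ 0 := by
    have : Continuous fun v => fderiv ℝ H v (0, 1) :=
      (hH.continuous_fderiv hne).clm_apply continuous_const
    exact this.continuousAt.eventually_ne hd
  have htend : Filter.Tendsto (fun x => (x, ψ x)) (𝓝 u.1) (𝓝 u) := by
    have : Filter.Tendsto (fun x => (x, ψ x)) (𝓝 u.1) (𝓝 (u.1, ψ u.1)) :=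
      continuousAt_id.prodMk hψc
    rwa [hψ0] at this
  -- Being `C^∞` at a point gives each finite order only on its own neighbourhood, so smoothness of
  -- `ψ` at nearby points is not automatic. The implicit function theorem is applied again at each
  -- nearby point of the graph, and local uniqueness identifies the new solution `φ` with `ψ`.
  have hsm : ∀ᶠ x in 𝓝 u.1, ContDiffAt ℝ ∞ ψ x := by
    filter_upwards [htend.eventually hiff.eventually_nhds, htend.eventually hdopen] with x hx1 hx2
    have hHx : H (x, ψ x) = 0 := hx1.self_of_nhds.2 rfl
    set φ := (hc (x, ψ x)).implicitFunction hne (hinv _ hx2) with hφ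
    have hφ0 : φ x = ψ x := (hc (x, ψ x)).implicitFunction_apply_self hne (hinv _ hx2)
    have hφs : ContDiffAt ℝ ∞ φ x :=
      (hc (x, ψ x)).contDiffAt_implicitFunction hne (hinv _ hx2)
    have hφe : ∀ᶠ y in 𝓝 x, H (y, φ y) = 0 := by
      have := (hc (x, ψ x)).eventually_apply_implicitFunction hne (hinv _ hx2)
      rwa [hHx] at this
    have ht : Filter.Tendsto (fun y => (y, φ y)) (𝓝 x) (𝓝 (x, ψ x)) := by
      have : Filter.Tendsto (fun y => (y, φ y)) (𝓝 x) (𝓝 (x, φ x)) :=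
        continuousAt_id.prodMk hφs.continuousAt
      rwa [hφ0] at this
    refine hφs.congr_of_eventuallyEq ?_
    filter_upwards [hφe, ht.eventually hx1] with y hy1 hy2
    exact hy2.1 hy1
  obtain ⟨f, hf, hfe⟩ := exists_contDiff_eventuallyEq hsm
  refine ⟨f, hf, ?_⟩
  filter_upwards [hiff, (continuous_fst.tendsto u).eventually hfe] with v hv1 hv2
  rw [hv1, hv2, eq_comm]

/-! ### Euclidean coordinates -/

/-- Splitting `ℝⁿ⁺¹ = ℝ × ℝⁿ`. -/
def splitL (n : ℕ) : Euc (n + 1) ≃L[ℝ] ℝ × Euc n :=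
  LinearEquiv.toContinuousLinearEquiv
    { toFun := fun v => (v 0, tail v)
      map_add' := fun v w => rfl
      map_smul' := fun r v => rfl
      invFun := fun z => join z.1 z.2
      left_inv := fun v => by
        ext i
        refine Fin.cases ?_ (fun j => ?_) i <;> simp [join, tail]
      right_inv := fun z => by
        refine Prod.ext ?_ ?_
        · simp [join]
        · ext i
          simp [join, tail] }

@[simp] lemma join_zero_apply {n : ℕ} (u : ℝ) (x : Euc n) : join u x 0 = u := rfl

@[simp] lemma tail_join {n : ℕ} (u : ℝ) (x : Euc n) : tail (join u x) = x := rfl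

@[simp] lemma join_tail {n : ℕ} (v : Euc (n + 1)) : join (v 0) (tail v) = v :=
  (splitL n).symm_apply_apply v

lemma join_eq {n : ℕ} (u : ℝ) (x : Euc n) : join u x = u • join 1 0 + join 0 x := by
  ext i
  refine Fin.cases ?_ (fun j => ?_) i <;> simp [join]

lemma inner_join {n : ℕ} (u u' : ℝ) (x x' : Euc n) :
    inner ℝ (join u x) (join u' x') = u * u' + inner ℝ x x' := by
  simp [PiLp.inner_apply, Fin.sum_univ_succ, join, mul_comm]

/-- The vector `∂_u` of the coordinates `c`. -/
def upVec {n : ℕ} (c : Isom n) : Euc (n + 1) := c.linearIsometryEquiv.symm (join 1 0)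

/-- The point over `x` of the graph `u = f(x)` in the coordinates `c`. -/
def graphMap {n : ℕ} (c : Isom n) (f : Euc n → ℝ) (x : Euc n) : Euc (n + 1) :=
  c.symm (join (f x) x)

/-- The vector with components `(d(v), v)` in the coordinates `c`: the lift of `v` to the
tangent space of a graph with differential `d`. -/
def liftVec {n : ℕ} (c : Isom n) (d : Euc n →L[ℝ] ℝ) : Euc n →L[ℝ] Euc (n + 1) :=
  (c.linearIsometryEquiv.symm.toContinuousLinearEquiv : Euc (n + 1) →L[ℝ] Euc (n + 1)) ∘L
    ((splitL n).symm : ℝ × Euc n →L[ℝ] Euc (n + 1)) ∘L (d.prod (ContinuousLinearMap.id ℝ (Euc n)))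

lemma liftVec_apply {n : ℕ} (c : Isom n) (d : Euc n →L[ℝ] ℝ) (v : Euc n) :
    liftVec c d v = c.linearIsometryEquiv.symm (join (d v) v) := rfl

lemma isom_apply_eq {n : ℕ} (c : Isom n) (q : Euc (n + 1)) :
    c q = c.linearIsometryEquiv q + c 0 := by
  simpa using c.map_vadd 0 q

lemma contDiff_isom {n : ℕ} (c : Isom n) : ContDiff ℝ ∞ c := by
  have : (c : Euc (n + 1) → Euc (n + 1)) = fun q => c.linearIsometryEquiv q + c 0 := by
    funext q
    exact isom_apply_eq c q
  rw [this]
  exact c.linearIsometryEquiv.contDiff.add contDiff_const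

lemma contDiff_tail {n : ℕ} : ContDiff ℝ ∞ (tail : Euc (n + 1) → Euc n) :=
  contDiff_snd.comp (splitL n).contDiff

lemma contDiff_xcoord {n : ℕ} (c : Isom n) : ContDiff ℝ ∞ (xcoord c) :=
  contDiff_tail.comp (contDiff_isom c)

lemma contDiff_ucoord {n : ℕ} (c : Isom n) : ContDiff ℝ ∞ (ucoord c) :=
  (contDiff_fst.comp (splitL n).contDiff).comp (contDiff_isom c)

lemma symm_join_coord {n : ℕ} (c : Isom n) (q : Euc (n + 1)) :
    c.symm (join (ucoord c q) (xcoord c q)) = q := by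
  unfold ucoord xcoord
  rw [join_tail, c.symm_apply_apply]

@[simp] lemma ucoord_symm_join {n : ℕ} (c : Isom n) (u : ℝ) (x : Euc n) :
    ucoord c (c.symm (join u x)) = u := by
  unfold ucoord
  rw [c.apply_symm_apply, join_zero_apply]

@[simp] lemma xcoord_symm_join {n : ℕ} (c : Isom n) (u : ℝ) (x : Euc n) :
    xcoord c (c.symm (join u x)) = x := by
  unfold xcoord
  rw [c.apply_symm_apply, tail_join]

lemma contDiff_symm_join {n : ℕ} (c : Isom n) :
    ContDiff ℝ ∞ fun z : ℝ × Euc n => c.symm (join z.1 z.2) :=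
  (contDiff_isom c.symm).comp (splitL n).symm.contDiff

lemma hasFDerivAt_isom {n : ℕ} (c : Isom n) (q : Euc (n + 1)) :
    HasFDerivAt c (c.linearIsometryEquiv.toContinuousLinearEquiv :
      Euc (n + 1) →L[ℝ] Euc (n + 1)) q := by
  have : (c : Euc (n + 1) → Euc (n + 1)) = fun q => c.linearIsometryEquiv q + c 0 := by
    funext q
    exact isom_apply_eq c q
  rw [this]
  exact (c.linearIsometryEquiv.toContinuousLinearEquiv.hasFDerivAt).add_const _

lemma contDiff_graphMap {n : ℕ} (c : Isom n) {f : Euc n → ℝ} (hf : ContDiff ℝ ∞ f) :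
    ContDiff ℝ ∞ (graphMap c f) :=
  (contDiff_symm_join c).comp (hf.prodMk contDiff_id)

lemma hasFDerivAt_graphMap {n : ℕ} (c : Isom n) {f : Euc n → ℝ} (hf : ContDiff ℝ ∞ f)
    (x : Euc n) : HasFDerivAt (graphMap c f) (liftVec c (fderiv ℝ f x)) x := by
  have h1 := (hf.differentiable (by simp) x).hasFDerivAt.prodMk (hasFDerivAt_id x)
  exact (hasFDerivAt_isom c.symm _).comp x (((splitL n).symm.hasFDerivAt).comp x h1)

/-- A covector in the coordinates `c`. -/
lemma covector_symm_join {n : ℕ} (c : Isom n) (ξ : Covector n) (u : ℝ) (x : Euc n) :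
    ξ (c.linearIsometryEquiv.symm (join u x)) =
      u * ξ (upVec c) + ξ (c.linearIsometryEquiv.symm (join 0 x)) := by
  rw [join_eq, map_add, map_add, map_smul, map_smul]
  rfl

/-- The covectors annihilating the tangent space of a graph are multiples of `du - df`. -/
lemma covector_eq_of_liftVec {n : ℕ} (c : Isom n) (d : Euc n →L[ℝ] ℝ) {ξ : Covector n}
    (h : ∀ v, ξ (liftVec c d v) = 0) (w : Euc (n + 1)) :
    ξ w = ξ (upVec c) *
      (c.linearIsometryEquiv w 0 - d (tail (c.linearIsometryEquiv w))) := by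
  have h1 := h (tail (c.linearIsometryEquiv w))
  rw [liftVec_apply, covector_symm_join] at h1
  have h2 := covector_symm_join c ξ (c.linearIsometryEquiv w 0) (tail (c.linearIsometryEquiv w))
  rw [join_tail, LinearIsometryEquiv.symm_apply_apply] at h2
  rw [h2]
  linarith

lemma IsGraphAt.ucoord_eq {n : ℕ} {c : Isom n} {X : PointedHypersurface n} {f : Euc n → ℝ}
    (h : IsGraphAt c X.S X.p f) : ucoord c X.p = f (xcoord c X.p) :=
  h.2.self_of_nhds.1 X.mem

lemma IsGraphAt.graphMap_xcoord {n : ℕ} {c : Isom n} {X : PointedHypersurface n}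
    {f : Euc n → ℝ} (h : IsGraphAt c X.S X.p f) : graphMap c f (xcoord c X.p) = X.p := by
  unfold graphMap
  rw [← h.ucoord_eq, symm_join_coord]

/-! ### Curves in graphs -/

/-- The curve in the graph of `f` over the line through `x` with velocity `v`. -/
def graphCurve {n : ℕ} (c : Isom n) (f : Euc n → ℝ) (x v : Euc n) (t : ℝ) : Euc (n + 1) :=
  graphMap c f (x + t • v)

lemma contDiff_line {n : ℕ} (x v : Euc n) : ContDiff ℝ ∞ fun t : ℝ => x + t • v :=
  contDiff_const.add (contDiff_id.smul contDiff_const)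

lemma hasDerivAt_line {n : ℕ} (x v : Euc n) (t : ℝ) :
    HasDerivAt (fun t : ℝ => x + t • v) v t := by
  simpa using ((hasDerivAt_id t).smul_const v).const_add x

lemma IsGraphAt.isCurve_graphCurve {n : ℕ} {c : Isom n} {X : PointedHypersurface n}
    {f : Euc n → ℝ} (h : IsGraphAt c X.S X.p f) (v : Euc n) :
    X.IsCurve (graphCurve c f (xcoord c X.p) v) := by
  have hs : ContDiff ℝ ∞ (graphCurve c f (xcoord c X.p) v) :=
    (contDiff_graphMap c h.1).comp (contDiff_line _ _)
  have h0 : graphCurve c f (xcoord c X.p) v 0 = X.p := by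
    simp [graphCurve, h.graphMap_xcoord]
  refine ⟨hs, h0, ?_⟩
  have ht := hs.continuous.tendsto 0
  rw [h0] at ht
  filter_upwards [ht.eventually h.2] with t ht
  rw [ht]
  simp [graphCurve, graphMap]

lemma hasDerivAt_graphCurve {n : ℕ} (c : Isom n) {f : Euc n → ℝ} (hf : ContDiff ℝ ∞ f)
    (x v : Euc n) : HasDerivAt (graphCurve c f x v) (liftVec c (fderiv ℝ f x) v) 0 := by
  have h1 : HasFDerivAt (graphMap c f) (liftVec c (fderiv ℝ f x)) (x + (0 : ℝ) • v) := by
    simpa using hasFDerivAt_graphMap c hf x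
  exact h1.comp_hasDerivAt 0 (hasDerivAt_line x v 0)

/-- A curve in a graph is the lift of its projection. -/
lemma IsGraphAt.eventually_curve {n : ℕ} {c : Isom n} {X : PointedHypersurface n}
    {f : Euc n → ℝ} (h : IsGraphAt c X.S X.p f) {γ : ℝ → Euc (n + 1)} (hγ : X.IsCurve γ) :
    ∀ᶠ t in 𝓝 (0 : ℝ), γ t = graphMap c f (xcoord c (γ t)) := by
  have ht := hγ.1.continuous.tendsto 0
  rw [hγ.2.1] at ht
  filter_upwards [ht.eventually h.2, hγ.2.2] with t h1 h2
  unfold graphMap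
  rw [← h1.1 h2, symm_join_coord]

lemma IsGraphAt.deriv_curve {n : ℕ} {c : Isom n} {X : PointedHypersurface n}
    {f : Euc n → ℝ} (h : IsGraphAt c X.S X.p f) {γ : ℝ → Euc (n + 1)} (hγ : X.IsCurve γ) :
    deriv γ 0 =
      liftVec c (fderiv ℝ f (xcoord c X.p)) (deriv (fun t => xcoord c (γ t)) 0) := by
  have hx : ContDiff ℝ ∞ fun t => xcoord c (γ t) := (contDiff_xcoord c).comp hγ.1
  have hd := ((hx.differentiable (by simp)) 0).hasDerivAt
  have h1 : HasFDerivAt (graphMap c f) (liftVec c (fderiv ℝ f (xcoord c X.p)))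
      (xcoord c (γ 0)) := by
    rw [hγ.2.1]
    exact hasFDerivAt_graphMap c h.1 _
  have he : γ =ᶠ[𝓝 0] graphMap c f ∘ fun t => xcoord c (γ t) := h.eventually_curve hγ
  exact ((h1.comp_hasDerivAt 0 hd).congr_of_eventuallyEq he).deriv

/-- The velocities of curves in a graph are exactly the lifts of vectors of `ℝⁿ`: every velocity is
such a lift, and the curves over straight lines realise all of them. -/
lemma IsGraphAt.isConormal_iff {n : ℕ} {c : Isom n} {X : PointedHypersurface n}
    {f : Euc n → ℝ} (h : IsGraphAt c X.S X.p f) (ξ : Covector n) :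
    X.IsConormal ξ ↔ ξ ≠ 0 ∧ ∀ v, ξ (liftVec c (fderiv ℝ f (xcoord c X.p)) v) = 0 := by
  refine and_congr_right fun _ => ⟨fun hξ v => ?_, fun hξ γ hγ => ?_⟩
  · have := hξ _ (h.isCurve_graphCurve v)
    rwa [(hasDerivAt_graphCurve c h.1 _ v).deriv] at this
  · rw [h.deriv_curve hγ, hξ]

/-- The second derivative as a bilinear map. -/
abbrev hess {E : Type*} [NormedAddCommGroup E] [NormedSpace ℝ E] (f : E → ℝ) (x : E) :
    E →L[ℝ] E →L[ℝ] ℝ := fderiv ℝ (fderiv ℝ f) x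

/-- In general the second derivative is `hess h (x', x') + dh(x'')`; the second term vanishes at a
critical point of `h`. -/
lemma iteratedDeriv_two_comp {E : Type*} [NormedAddCommGroup E] [NormedSpace ℝ E] {h : E → ℝ}
    (hh : ContDiff ℝ ∞ h) {x : ℝ → E} (hx : ContDiff ℝ ∞ x) (h0 : fderiv ℝ h (x 0) = 0) :
    iteratedDeriv 2 (fun t => h (x t)) 0 = hess h (x 0) (deriv x 0) (deriv x 0) := by
  have hxd : ∀ t, HasDerivAt x (deriv x t) t := fun t =>
    ((hx.differentiable (by simp)) t).hasDerivAt
  have h1 : deriv (fun t => h (x t)) = fun t => fderiv ℝ h (x t) (deriv x t) := by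
    funext t
    exact (((hh.differentiable (by simp)) (x t)).hasFDerivAt.comp_hasDerivAt t (hxd t)).deriv
  have hdd : HasDerivAt (deriv x) (deriv (deriv x) 0) 0 :=
    (((contDiff_infty_iff_deriv.1 hx).2.differentiable (by simp)) 0).hasDerivAt
  have hf : HasDerivAt (fun t => fderiv ℝ h (x t)) (hess h (x 0) (deriv x 0)) 0 :=
    (((hh.fderiv_right (m := ∞) (by simp)).differentiable (by simp)) (x 0)).hasFDerivAt.comp_hasDerivAt
      0 (hxd 0)
  rw [iteratedDeriv_succ, iteratedDeriv_one, h1, (hf.clm_apply hdd).deriv, h0]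
  simp

lemma covector_iteratedDeriv {n : ℕ} (ξ : Covector n) {γ : ℝ → Euc (n + 1)}
    (hγ : ContDiff ℝ ∞ γ) : ξ (iteratedDeriv 2 γ 0) = iteratedDeriv 2 (fun t => ξ (γ t)) 0 := by
  have h1 : deriv (fun t => ξ (γ t)) = fun t => ξ (deriv γ t) := by
    funext t
    exact (ξ.hasFDerivAt.comp_hasDerivAt t ((hγ.differentiable (by simp)) t).hasDerivAt).deriv
  have hdd : HasDerivAt (deriv γ) (deriv (deriv γ) 0) 0 :=
    (((contDiff_infty_iff_deriv.1 hγ).2.differentiable (by simp)) 0).hasDerivAt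
  rw [iteratedDeriv_succ, iteratedDeriv_one, iteratedDeriv_succ, iteratedDeriv_one, h1]
  exact (ξ.hasFDerivAt.comp_hasDerivAt 0 hdd).deriv.symm

lemma fderiv_covector_graphMap {n : ℕ} (c : Isom n) {f : Euc n → ℝ} (hf : ContDiff ℝ ∞ f)
    (ξ : Covector n) (x : Euc n) :
    fderiv ℝ (fun y => ξ (graphMap c f y)) x = ξ ∘L liftVec c (fderiv ℝ f x) :=
  (ξ.hasFDerivAt.comp x (hasFDerivAt_graphMap c hf x)).fderiv

/-- Along the graph, `ξ` equals `ξ(∂_u) f` plus an affine function of `x`, which does not contribute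
to the Hessian. -/
lemma hess_covector_graphMap {n : ℕ} (c : Isom n) {f : Euc n → ℝ} (hf : ContDiff ℝ ∞ f)
    (ξ : Covector n) (x v w : Euc n) :
    hess (fun y => ξ (graphMap c f y)) x v w = hess f x v w * ξ (upVec c) := by
  have h1 : fderiv ℝ (fun y => ξ (graphMap c f y)) =
      fun y => ξ (upVec c) • fderiv ℝ f y + ξ ∘L liftVec c 0 := by
    funext y
    rw [fderiv_covector_graphMap c hf]
    ext v
    simp only [ContinuousLinearMap.comp_apply, liftVec_apply, add_apply, smul_apply,
      zero_apply, smul_eq_mul]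
    rw [covector_symm_join]
    ring
  have hd : HasFDerivAt (fderiv ℝ f) (hess f x) x :=
    (((hf.fderiv_right (m := ∞) (by simp)).differentiable (by simp)) x).hasFDerivAt
  have h2 := ((hd.const_smul (ξ (upVec c))).add_const (ξ ∘L liftVec c 0)).fderiv
  rw [hess, h1]
  rw [show fderiv ℝ (fun y => ξ (upVec c) • fderiv ℝ f y + ξ ∘L liftVec c 0) x = _ from h2]
  simp [mul_comm]

/-- A conormal composed with the graph map has a critical point at the marked point, so the
acceleration of the projected curve drops out. This is why the normal acceleration depends on the
velocity alone. -/
lemma IsGraphAt.iteratedDeriv_curve {n : ℕ} {c : Isom n} {X : PointedHypersurface n}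
    {f : Euc n → ℝ} (h : IsGraphAt c X.S X.p f) {ξ : Covector n} (hξ : X.IsConormal ξ)
    {γ : ℝ → Euc (n + 1)} (hγ : X.IsCurve γ) :
    ξ (iteratedDeriv 2 γ 0) = hess f (xcoord c X.p) (deriv (fun t => xcoord c (γ t)) 0)
      (deriv (fun t => xcoord c (γ t)) 0) * ξ (upVec c) := by
  have hx : ContDiff ℝ ∞ fun t => xcoord c (γ t) := (contDiff_xcoord c).comp hγ.1
  have he : (fun t => ξ (γ t)) =ᶠ[𝓝 0] fun t => ξ (graphMap c f (xcoord c (γ t))) := by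
    filter_upwards [h.eventually_curve hγ] with t ht
    rw [← ht]
  rw [covector_iteratedDeriv ξ hγ.1, he.iteratedDeriv_eq 2]
  rw [iteratedDeriv_two_comp (h := fun y => ξ (graphMap c f y))
    (ξ.contDiff.comp (contDiff_graphMap c h.1)) hx, hess_covector_graphMap c h.1]
  · simp only [hγ.2.1]
  · rw [fderiv_covector_graphMap c h.1]
    ext v
    simp only [hγ.2.1]
    exact ((h.isConormal_iff ξ).1 hξ).2 v

lemma IsGraphAt.isSFF_iff {n : ℕ} {c : Isom n} {X : PointedHypersurface n}
    {f : Euc n → ℝ} (h : IsGraphAt c X.S X.p f) {ξ : Covector n} (hξ : X.IsConormal ξ)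
    (β : SymBil (Hyp ξ)) :
    X.IsSFF ξ β ↔ ∀ (v : Euc n) (w : Hyp ξ),
      (w : Euc (n + 1)) = liftVec c (fderiv ℝ f (xcoord c X.p)) v →
        β.1 w w = hess f (xcoord c X.p) v v * ξ (upVec c) := by
  constructor
  · intro hβ v w hw
    have hγ := h.isCurve_graphCurve v
    have hd : deriv (fun t => xcoord c (graphCurve c f (xcoord c X.p) v t)) 0 = v := by
      have : (fun t => xcoord c (graphCurve c f (xcoord c X.p) v t)) =
          fun t => xcoord c X.p + t • v := by
        funext t
        simp [graphCurve, graphMap]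
      rw [this]
      exact (hasDerivAt_line _ v 0).deriv
    have h1 := hβ _ hγ w (by rw [hw, (hasDerivAt_graphCurve c h.1 _ v).deriv])
    rw [h1, h.iteratedDeriv_curve hξ hγ, hd]
  · intro hβ γ hγ w hw
    rw [h.iteratedDeriv_curve hξ hγ]
    exact hβ _ w (by rw [hw, h.deriv_curve hγ])

/-- A hypersurface whose tangent space is transversal to `∂_u` is a graph. -/
lemma PointedHypersurface.IsConormal.exists_isGraphAt {n : ℕ} {X : PointedHypersurface n}
    {ξ : Covector n} (hξ : X.IsConormal ξ) {c : Isom n} (hc : ξ (upVec c) ≠ 0) :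
    ∃ f, IsGraphAt c X.S X.p f := by
  obtain ⟨c₁, f₁, h₁⟩ := X.isHypersurface X.p X.mem
  set G : Euc (n + 1) → ℝ := fun q => ucoord c₁ q - f₁ (xcoord c₁ q) with hG
  have hGs : ContDiff ℝ ∞ G := (contDiff_ucoord c₁).sub (h₁.1.comp (contDiff_xcoord c₁))
  -- The conormal `ξ` is a multiple of the differential of the local equation `G`, so `ξ(∂_u) ≠ 0`
  -- forces `G` to have nonzero derivative along `∂_u`.
  have hGd : fderiv ℝ G X.p (upVec c) ≠ 0 := by
    intro h0
    apply hc
    rw [covector_eq_of_liftVec c₁ _ ((h₁.isConormal_iff ξ).1 hξ).2 (upVec c)]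
    have hu : HasFDerivAt (fun q => splitL n (c₁ q)) _ X.p :=
      (splitL n).hasFDerivAt.comp X.p (hasFDerivAt_isom c₁ X.p)
    have hfd := (h₁.1.differentiable (by simp) (xcoord c₁ X.p)).hasFDerivAt
    have hGd : HasFDerivAt G _ X.p := hu.fst.sub (hfd.comp X.p hu.snd)
    rw [hGd.fderiv] at h0
    change (c₁.linearIsometryEquiv (upVec c) 0 -
      fderiv ℝ f₁ (xcoord c₁ X.p) (tail (c₁.linearIsometryEquiv (upVec c)))) = 0 at h0
    rw [h0, mul_zero]
  -- The coordinates are swapped so that `u`, the variable to be solved for, is the second factor.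
  set H : Euc n × ℝ → ℝ := fun z => G (c.symm (join z.2 z.1)) with hH
  have hHs : ContDiff ℝ ∞ H :=
    hGs.comp ((contDiff_symm_join c).comp (contDiff_snd.prodMk contDiff_fst))
  have hp : c.symm (join (ucoord c X.p) (xcoord c X.p)) = X.p := symm_join_coord c X.p
  have hH0 : H (xcoord c X.p, ucoord c X.p) = 0 := by
    simp only [hH, hG, hp, h₁.ucoord_eq, sub_self]
  have hHd : fderiv ℝ H (xcoord c X.p, ucoord c X.p) (0, 1) ≠ 0 := by
    have h1 : HasFDerivAt (fun z : Euc n × ℝ => c.symm (join z.2 z.1)) _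
        (xcoord c X.p, ucoord c X.p) :=
      (hasFDerivAt_isom c.symm _).comp _ (((splitL n).symm.hasFDerivAt).comp _
        ((hasFDerivAt_snd).prodMk (hasFDerivAt_fst)))
    have h2 : HasFDerivAt G (fderiv ℝ G X.p)
        (c.symm (join (ucoord c X.p) (xcoord c X.p))) := by
      rw [hp]
      exact (hGs.differentiable (by simp) _).hasFDerivAt
    have h3 := (h2.comp (xcoord c X.p, ucoord c X.p) h1).fderiv
    rw [show fderiv ℝ H _ = _ from h3]
    exact hGd
  obtain ⟨f, hf, hfe⟩ := exists_contDiff_implicit hHs hH0 hHd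
  refine ⟨f, hf, ?_⟩
  have ht : Filter.Tendsto (fun q => (xcoord c q, ucoord c q)) (𝓝 X.p)
      (𝓝 (xcoord c X.p, ucoord c X.p)) :=
    ((contDiff_xcoord c).continuous.prodMk (contDiff_ucoord c).continuous).tendsto _
  filter_upwards [ht.eventually hfe, h₁.2] with q hq1 hq2
  rw [hq2, ← hq1]
  simp only [hH, hG, symm_join_coord, sub_eq_zero]

/-! ### Conormals and second fundamental forms of jets -/

/-- The covector `du - d` in the coordinates `c`. -/
def graphCovector {n : ℕ} (c : Isom n) (d : Euc n →L[ℝ] ℝ) : Covector n :=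
  ((ContinuousLinearMap.fst ℝ ℝ (Euc n) - d ∘L ContinuousLinearMap.snd ℝ ℝ (Euc n)) ∘L
    (splitL n : Euc (n + 1) →L[ℝ] ℝ × Euc n)) ∘L
    (c.linearIsometryEquiv.toContinuousLinearEquiv : Euc (n + 1) →L[ℝ] Euc (n + 1))

lemma graphCovector_apply {n : ℕ} (c : Isom n) (d : Euc n →L[ℝ] ℝ) (w : Euc (n + 1)) :
    graphCovector c d w =
      c.linearIsometryEquiv w 0 - d (tail (c.linearIsometryEquiv w)) := rfl

lemma graphCovector_upVec {n : ℕ} (c : Isom n) (d : Euc n →L[ℝ] ℝ) :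
    graphCovector c d (upVec c) = 1 := by
  have h0 : tail (join (1 : ℝ) (0 : Euc n)) = 0 := rfl
  rw [graphCovector_apply, upVec, LinearIsometryEquiv.apply_symm_apply, h0]
  simp

lemma graphCovector_liftVec {n : ℕ} (c : Isom n) (d : Euc n →L[ℝ] ℝ) (v : Euc n) :
    graphCovector c d (liftVec c d v) = 0 := by
  rw [graphCovector_apply, liftVec_apply, LinearIsometryEquiv.apply_symm_apply]
  simp

lemma graphCovector_ne_zero {n : ℕ} (c : Isom n) (d : Euc n →L[ℝ] ℝ) :
    graphCovector c d ≠ 0 := by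
  intro h
  have := graphCovector_upVec c d
  rw [h] at this
  simp at this

lemma eq_smul_graphCovector {n : ℕ} (c : Isom n) (d : Euc n →L[ℝ] ℝ) {ξ : Covector n}
    (h : ∀ v, ξ (liftVec c d v) = 0) : ξ = ξ (upVec c) • graphCovector c d := by
  ext w
  rw [covector_eq_of_liftVec c d h w]
  rfl

lemma upVec_ne_zero_of_liftVec {n : ℕ} {c : Isom n} {d : Euc n →L[ℝ] ℝ} {ξ : Covector n}
    (hξ : ξ ≠ 0) (h : ∀ v, ξ (liftVec c d v) = 0) : ξ (upVec c) ≠ 0 := by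
  intro h0
  apply hξ
  rw [eq_smul_graphCovector c d h, h0, zero_smul]

/-- Up to the nonzero factor `ξ(∂_u)`, the covector is `du - d`, from which `d` can be read off. -/
lemma differential_eq_of_liftVec {n : ℕ} {c : Isom n} {d d' : Euc n →L[ℝ] ℝ} {ξ : Covector n}
    (hξ : ξ ≠ 0) (h : ∀ v, ξ (liftVec c d v) = 0) (h' : ∀ v, ξ (liftVec c d' v) = 0) :
    d = d' := by
  ext v
  have h1 := h v
  have h2 := h' v
  rw [liftVec_apply, covector_symm_join] at h1 h2
  exact mul_right_cancel₀ (upVec_ne_zero_of_liftVec hξ h) (by linarith)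

namespace PointedHypersurface

variable {n : ℕ} {X Y : PointedHypersurface n} {ξ η : Covector n}

lemma exists_isConormal (X : PointedHypersurface n) : ∃ ξ, X.IsConormal ξ := by
  obtain ⟨c, f, h⟩ := X.isHypersurface X.p X.mem
  exact ⟨graphCovector c (fderiv ℝ f (xcoord c X.p)),
    (h.isConormal_iff _).2 ⟨graphCovector_ne_zero _ _, graphCovector_liftVec _ _⟩⟩

lemma IsConormal.smul (h : X.IsConormal ξ) {r : ℝ} (hr : r ≠ 0) : X.IsConormal (r • ξ) :=
  ⟨smul_ne_zero hr h.1, fun γ hγ => by simp [h.2 γ hγ]⟩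

lemma IsConormal.exists_smul (h : X.IsConormal ξ) (h' : X.IsConormal η) :
    ∃ r : ℝ, r ≠ 0 ∧ η = r • ξ := by
  obtain ⟨c, f, hf⟩ := X.isHypersurface X.p X.mem
  have h1 := (hf.isConormal_iff _).1 h
  have h2 := (hf.isConormal_iff _).1 h'
  have n1 := upVec_ne_zero_of_liftVec h1.1 h1.2
  have n2 := upVec_ne_zero_of_liftVec h2.1 h2.2
  refine ⟨η (upVec c) / ξ (upVec c), div_ne_zero n2 n1, ?_⟩
  conv_lhs => rw [eq_smul_graphCovector c _ h2.2]
  conv_rhs => rw [eq_smul_graphCovector c _ h1.2]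
  rw [smul_smul]
  congr 1
  rw [smul_apply, graphCovector_upVec, smul_eq_mul, mul_one]
  field_simp

end PointedHypersurface

lemma iteratedFDeriv_one_eq_iff {E : Type*} [NormedAddCommGroup E] [NormedSpace ℝ E]
    {f g : E → ℝ} {x : E} :
    iteratedFDeriv ℝ 1 f x = iteratedFDeriv ℝ 1 g x ↔ fderiv ℝ f x = fderiv ℝ g x := by
  constructor
  · intro h
    ext v
    simpa using congrArg (fun T => T fun _ => v) h
  · intro h
    ext m
    simp [h]

lemma iteratedFDeriv_two_eq_iff {E : Type*} [NormedAddCommGroup E] [NormedSpace ℝ E]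
    {f g : E → ℝ} {x : E} :
    iteratedFDeriv ℝ 2 f x = iteratedFDeriv ℝ 2 g x ↔ hess f x = hess g x := by
  constructor
  · intro h
    ext v w
    simpa [iteratedFDeriv_two_apply] using congrArg (fun T => T ![v, w]) h
  · intro h
    ext m
    rw [iteratedFDeriv_two_apply, iteratedFDeriv_two_apply]
    exact congrArg (fun T => T (m 0) (m 1)) h

/-- The Hessian as a symmetric form. -/
def hessSym {n : ℕ} {f : Euc n → ℝ} (hf : ContDiff ℝ ∞ f) (x : Euc n) : SymBil (Euc n) :=
  ⟨hess f x, fun v w => (hf.contDiffAt.isSymmSndFDerivAt (by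
    rw [minSmoothness_of_isRCLikeNormedField]
    exact WithTop.coe_le_coe.2 (le_top : (2 : ℕ∞) ≤ ⊤))) v w⟩

lemma coe_hessSym {n : ℕ} {f : Euc n → ℝ} (hf : ContDiff ℝ ∞ f) (x : Euc n) :
    hess f x = (hessSym hf x).1 := rfl

/-! ### Second fundamental forms in a chart, and equivalence of pointed hypersurfaces. -/

section Chart

variable {n : ℕ} {ξ η : Covector n}

/-- The tangent hyperplane of a graph is identified with `ℝⁿ` by the coordinates. -/
def hypEquiv (c : Isom n) (d : Euc n →L[ℝ] ℝ) (hξ : ξ ≠ 0)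
    (h : ∀ v, ξ (liftVec c d v) = 0) : Hyp ξ ≃L[ℝ] Euc n :=
  LinearEquiv.toContinuousLinearEquiv
    { toFun := fun w => tail (c.linearIsometryEquiv (w : Euc (n + 1)))
      map_add' := fun v w => by
        rw [Submodule.coe_add, map_add]
        rfl
      map_smul' := fun r v => by
        rw [Submodule.coe_smul, map_smul]
        rfl
      invFun := fun v => ⟨liftVec c d v, h v⟩
      left_inv := fun w => by
        apply Subtype.ext
        have h1 : ξ (w : Euc (n + 1)) = 0 := w.2
        rw [covector_eq_of_liftVec c d h] at h1
        have h2 := (mul_eq_zero.1 h1).resolve_left (upVec_ne_zero_of_liftVec hξ h)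
        show liftVec c d (tail (c.linearIsometryEquiv (w : Euc (n + 1)))) = w
        rw [liftVec_apply, ← sub_eq_zero.1 h2, join_tail, LinearIsometryEquiv.symm_apply_apply]
      right_inv := fun v => by
        show tail (c.linearIsometryEquiv (liftVec c d v)) = v
        rw [liftVec_apply, LinearIsometryEquiv.apply_symm_apply, tail_join] }

/-- The defining condition only tests the quadratic form on tangent vectors, and polarisation
recovers the bilinear form. The right-hand side is linear in the Hessian, the source of both
existence and linearity in the `u_{ij}`. -/
lemma IsGraphAt.isSFF_iff_eq {c : Isom n} {X : PointedHypersurface n}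
    {f : Euc n → ℝ} (h : IsGraphAt c X.S X.p f) {d : Euc n →L[ℝ] ℝ} {b : SymBil (Euc n)}
    (hfd : fderiv ℝ f (xcoord c X.p) = d) (hfb : hess f (xcoord c X.p) = b.1) (hξ : ξ ≠ 0)
    (hd : ∀ v, ξ (liftVec c d v) = 0) (β : SymBil (Hyp ξ)) :
    X.IsSFF ξ β ↔ ξ (upVec c) • pullbackEquiv (hypEquiv c d hξ hd) b = β := by
  subst hfd
  have hbv : ∀ v, hess f (xcoord c X.p) v v = b.1 v v := fun v => congrArg (fun T => T v v) hfb
  rw [h.isSFF_iff ((h.isConormal_iff ξ).2 ⟨hξ, hd⟩)]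
  simp only [hbv]
  generalize fderiv ℝ f (xcoord c X.p) = d at hd ⊢
  constructor
  · intro hβ
    refine SymBil.ext_diag fun w => ?_
    have hw : (w : Euc (n + 1)) = liftVec c d (hypEquiv c d hξ hd w) :=
      (congrArg Subtype.val ((hypEquiv c d hξ hd).symm_apply_apply w)).symm
    exact (mul_comm _ _).trans (hβ _ w hw).symm
  · rintro rfl v w hw
    have : w = (hypEquiv c d hξ hd).symm v := Subtype.ext hw
    subst this
    show ξ (upVec c) * b.1 (hypEquiv c d hξ hd ((hypEquiv c d hξ hd).symm v))
      (hypEquiv c d hξ hd ((hypEquiv c d hξ hd).symm v)) = _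
    rw [ContinuousLinearEquiv.apply_symm_apply, mul_comm]

lemma PointedHypersurface.IsConormal.existsUnique_isSFF {X : PointedHypersurface n}
    (hξ : X.IsConormal ξ) : ∃! β, X.IsSFF ξ β := by
  obtain ⟨c, f, h⟩ := X.isHypersurface X.p X.mem
  have h1 := (h.isConormal_iff ξ).1 hξ
  have key := h.isSFF_iff_eq rfl (coe_hessSym h.1 _) h1.1 h1.2
  exact ⟨_, (key _).2 rfl, fun β hβ => ((key β).1 hβ).symm⟩

lemma LEquiv.isConormal {X Y : PointedHypersurface n} (h : LEquiv 1 X Y) :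
    X.IsConormal ξ ↔ Y.IsConormal ξ := by
  obtain ⟨hp, c, f, g, hf, hg, hk⟩ := h
  rw [hf.isConormal_iff, hg.isConormal_iff, iteratedFDeriv_one_eq_iff.1 (hk 1 le_rfl), hp]

lemma LEquiv.one_of_two {X Y : PointedHypersurface n} (h : LEquiv 2 X Y) : LEquiv 1 X Y := by
  obtain ⟨hp, c, f, g, hf, hg, hk⟩ := h
  exact ⟨hp, c, f, g, hf, hg, fun k hk1 => hk k (by omega)⟩

lemma LEquiv.isSFF {X Y : PointedHypersurface n} (h : LEquiv 2 X Y) (hξ : X.IsConormal ξ)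
    (β : SymBil (Hyp ξ)) : X.IsSFF ξ β ↔ Y.IsSFF ξ β := by
  have hξ' := h.one_of_two.isConormal.1 hξ
  obtain ⟨hp, c, f, g, hf, hg, hk⟩ := h
  rw [hf.isSFF_iff hξ, hg.isSFF_iff hξ', iteratedFDeriv_one_eq_iff.1 (hk 1 one_le_two),
    iteratedFDeriv_two_eq_iff.1 (hk 2 le_rfl), hp]

/-- Equality in the quotient only says that `X` and `Y` are linked by the equivalence generated by
`LEquiv`. Lifting the proposition itself to the quotient avoids proving transitivity. -/
lemma jet_one_eq {X Y : PointedHypersurface n} (h : jet 1 X = jet 1 Y) :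
    X.IsConormal ξ ↔ Y.IsConormal ξ := by
  have := congrArg (Quot.lift (fun X : PointedHypersurface n => X.IsConormal ξ)
    fun _ _ h => propext (LEquiv.isConormal h)) h
  exact iff_of_eq this

/-- As for 1-jets; the conjunction is lifted because `LEquiv.isSFF` needs `ξ` to be a conormal. -/
lemma jet_two_eq {X Y : PointedHypersurface n} (h : jet 2 X = jet 2 Y) {β : SymBil (Hyp ξ)} :
    (X.IsConormal ξ ∧ X.IsSFF ξ β) ↔ (Y.IsConormal ξ ∧ Y.IsSFF ξ β) := by
  have := congrArg (Quot.lift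
    (fun X : PointedHypersurface n => X.IsConormal ξ ∧ X.IsSFF ξ β) fun X Y h => propext (by
      constructor
      · rintro ⟨h1, h2⟩
        exact ⟨h.one_of_two.isConormal.1 h1, (h.isSFF h1 β).1 h2⟩
      · rintro ⟨h1, h2⟩
        have h1' := h.one_of_two.isConormal.2 h1
        exact ⟨h1', (h.isSFF h1' β).2 h2⟩)) h
  exact iff_of_eq this

lemma isConormal_jet {X : PointedHypersurface n} : IsConormal (jet 1 X) ξ ↔ X.IsConormal ξ :=
  ⟨fun ⟨_, h, hY⟩ => (jet_one_eq h).1 hY, fun h => ⟨X, rfl, h⟩⟩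

lemma isSFF_jet {X : PointedHypersurface n} (hξ : X.IsConormal ξ) {β : SymBil (Hyp ξ)} :
    IsSFF (jet 2 X) ξ β ↔ X.IsSFF ξ β := by
  refine ⟨fun ⟨Y, h, hY⟩ => ?_, fun h => ⟨X, rfl, h⟩⟩
  have h1 : jet 1 Y = jet 1 X := congrArg Jet.proj h
  exact ((jet_two_eq h).1 ⟨(jet_one_eq h1).2 hξ, hY⟩).2

/-- A chart in which `X` is a graph also presents `Y` as a graph, since the common conormal does not
annihilate `∂_u`. In this common chart the conormal fixes the differential. -/
lemma lEquiv_one_of_isConormal {X Y : PointedHypersurface n} (hp : X.p = Y.p)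
    (hX : X.IsConormal ξ) (hY : Y.IsConormal ξ) : LEquiv 1 X Y := by
  obtain ⟨c, f, hf⟩ := X.isHypersurface X.p X.mem
  have h1 := (hf.isConormal_iff ξ).1 hX
  obtain ⟨g, hg⟩ := hY.exists_isGraphAt (upVec_ne_zero_of_liftVec h1.1 h1.2)
  have h2 := (hg.isConormal_iff ξ).1 hY
  refine ⟨hp, c, f, g, hf, hg, fun k hk => ?_⟩
  interval_cases k
  · ext m
    have e1 := hf.ucoord_eq
    have e2 := hg.ucoord_eq
    rw [← hp] at e2
    simp [← e1, ← e2]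
  · rw [iteratedFDeriv_one_eq_iff]
    rw [← hp] at h2
    exact differential_eq_of_liftVec hX.1 h1.2 h2.2

/-- In a common chart the Hessian on the diagonal is the second fundamental form divided by
`ξ(∂_u)`, hence the same for both. -/
lemma lEquiv_two_of_isSFF {X Y : PointedHypersurface n} (hp : X.p = Y.p)
    (hX : X.IsConormal ξ) (hY : Y.IsConormal ξ) {β : SymBil (Hyp ξ)} (hXβ : X.IsSFF ξ β)
    (hYβ : Y.IsSFF ξ β) : LEquiv 2 X Y := by
  obtain ⟨c, f, hf⟩ := X.isHypersurface X.p X.mem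
  have h1 := (hf.isConormal_iff ξ).1 hX
  have hu := upVec_ne_zero_of_liftVec h1.1 h1.2
  obtain ⟨g, hg⟩ := hY.exists_isGraphAt hu
  have h2 := (hg.isConormal_iff ξ).1 hY
  have e1 := hf.ucoord_eq
  have e2 := hg.ucoord_eq
  have s1 := (hf.isSFF_iff hX β).1 hXβ
  have s2 := (hg.isSFF_iff hY β).1 hYβ
  rw [← hp] at e2 h2 s2
  have hd := differential_eq_of_liftVec hX.1 h1.2 h2.2
  refine ⟨hp, c, f, g, hf, hg, fun k hk => ?_⟩
  interval_cases k
  · ext m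
    simp [← e1, ← e2]
  · rwa [iteratedFDeriv_one_eq_iff]
  · rw [iteratedFDeriv_two_eq_iff]
    have : hessSym hf.1 (xcoord c X.p) = hessSym hg.1 (xcoord c X.p) := by
      refine SymBil.ext_diag fun v => ?_
      have a1 := s1 v ⟨_, h1.2 v⟩ rfl
      have a2 := s2 v ⟨_, h1.2 v⟩ (congrArg (fun d => liftVec c d v) hd)
      exact mul_right_cancel₀ hu (a1.symm.trans a2)
    exact congrArg Subtype.val this

end Chart

/-! ### Jets are determined by point, conormal and second fundamental form -/

section JetLevel

variable {n : ℕ} {ξ η : Covector n}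

lemma Jet.base_proj (a : Jet n 2) : a.proj.base = a.base := by
  induction a using Quot.ind
  rfl

lemma exists_isConormal (a : Jet n 1) : ∃ ξ, IsConormal a ξ := by
  induction a using Quot.ind with
  | mk X =>
    obtain ⟨ξ, h⟩ := X.exists_isConormal
    exact ⟨ξ, X, rfl, h⟩

lemma IsConormal.ne_zero {a : Jet n 1} (h : IsConormal a ξ) : ξ ≠ 0 := by
  obtain ⟨X, -, h⟩ := h
  exact h.1

lemma IsUnitConormal.ne_zero {a : Jet n 1} (h : IsUnitConormal a ξ) : ξ ≠ 0 := h.1.ne_zero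

lemma IsConormal.smul {a : Jet n 1} (h : IsConormal a ξ) {r : ℝ} (hr : r ≠ 0) :
    IsConormal a (r • ξ) := by
  obtain ⟨X, rfl, h⟩ := h
  exact ⟨X, rfl, h.smul hr⟩

lemma IsConormal.exists_smul {a : Jet n 1} (h : IsConormal a ξ) (h' : IsConormal a η) :
    ∃ r : ℝ, r ≠ 0 ∧ η = r • ξ := by
  obtain ⟨X, rfl, h⟩ := h
  exact h.exists_smul (isConormal_jet.1 h')

lemma IsUnitConormal.neg {a : Jet n 1} (h : IsUnitConormal a ξ) : IsUnitConormal a (-ξ) := by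
  refine ⟨?_, by rw [norm_neg, h.2]⟩
  simpa using h.1.smul (r := -1) (by norm_num)

lemma IsUnitConormal.eq_or_eq_neg {a : Jet n 1} (h : IsUnitConormal a ξ)
    (h' : IsUnitConormal a η) : η = ξ ∨ η = -ξ := by
  obtain ⟨r, -, rfl⟩ := h.1.exists_smul h'.1
  have hr := h'.2
  rw [norm_smul, h.2, mul_one, Real.norm_eq_abs] at hr
  rcases (abs_eq zero_le_one).1 hr with rfl | rfl
  · left
    simp
  · right
    simp

lemma exists_isUnitConormal (a : Jet n 1) : ∃ ξ, IsUnitConormal a ξ := by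
  obtain ⟨ξ, h⟩ := exists_isConormal a
  have h0 : ‖ξ‖ ≠ 0 := norm_ne_zero_iff.2 h.ne_zero
  refine ⟨‖ξ‖⁻¹ • ξ, h.smul (inv_ne_zero h0), ?_⟩
  rw [norm_smul, norm_inv, norm_norm, inv_mul_cancel₀ h0]

lemma Jet.ext_one {a b : Jet n 1} (hb : a.base = b.base) (ha : IsConormal a ξ)
    (hb' : IsConormal b ξ) : a = b := by
  obtain ⟨X, rfl, hX⟩ := ha
  obtain ⟨Y, rfl, hY⟩ := hb'
  exact Quot.sound (lEquiv_one_of_isConormal hb hX hY)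

lemma Jet.ext_two {a b : Jet n 2} (hb : a.base = b.base) (ha : IsConormal a.proj ξ)
    (hb' : IsConormal b.proj ξ) {β : SymBil (Hyp ξ)} (haβ : IsSFF a ξ β) (hbβ : IsSFF b ξ β) :
    a = b := by
  obtain ⟨X, rfl, hX⟩ := haβ
  obtain ⟨Y, rfl, hY⟩ := hbβ
  exact Quot.sound (lEquiv_two_of_isSFF hb (isConormal_jet.1 ha) (isConormal_jet.1 hb') hX hY)

lemma IsConormal.existsUnique_isSFF {a : Jet n 2} (h : IsConormal a.proj ξ) :
    ∃! β, IsSFF a ξ β := by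
  induction a using Quot.ind with
  | mk X =>
    have hX := isConormal_jet.1 h
    obtain ⟨β, h1, h2⟩ := hX.existsUnique_isSFF
    exact ⟨β, (isSFF_jet hX).2 h1, fun γ hγ => h2 γ ((isSFF_jet hX).1 hγ)⟩

/-! ### Jet coordinates -/

lemma hasFDerivAt_taylor (z : JetCoord n) (y : Euc n) :
    HasFDerivAt (taylor z) (z.2.2.1 + z.2.2.2.1 (y - z.2.1)) y := by
  have hs : HasFDerivAt (fun y : Euc n => y - z.2.1) (ContinuousLinearMap.id ℝ (Euc n)) y :=
    (hasFDerivAt_id y).sub_const _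
  have h1 : HasFDerivAt (fun y : Euc n => z.2.2.1 (y - z.2.1)) _ y :=
    z.2.2.1.hasFDerivAt.comp y hs
  have h2 : HasFDerivAt (fun y : Euc n => z.2.2.2.1 (y - z.2.1)) _ y :=
    z.2.2.2.1.hasFDerivAt.comp y hs
  have h3 := (h2.clm_apply hs).const_mul (1 / 2 : ℝ)
  have h4 := (h1.const_add z.1).add h3
  refine h4.congr_fderiv ?_
  ext v
  have h5 : z.2.2.2.1 v (y - z.2.1) = z.2.2.2.1 (y - z.2.1) v := z.2.2.2.2 _ _
  show z.2.2.1 v + (1 / 2 : ℝ) * (z.2.2.2.1 (y - z.2.1) v + z.2.2.2.1 v (y - z.2.1)) =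
    z.2.2.1 v + z.2.2.2.1 (y - z.2.1) v
  rw [h5]
  ring

lemma fderiv_taylor (z : JetCoord n) : fderiv ℝ (taylor z) z.2.1 = z.2.2.1 := by
  rw [(hasFDerivAt_taylor z _).fderiv]
  simp

lemma hess_taylor (z : JetCoord n) (y : Euc n) : hess (taylor z) y = z.2.2.2.1 := by
  have : fderiv ℝ (taylor z) = fun y => z.2.2.1 + z.2.2.2.1 (y - z.2.1) :=
    funext fun y => (hasFDerivAt_taylor z y).fderiv
  rw [hess, this]
  exact ((z.2.2.2.1.hasFDerivAt.comp y ((hasFDerivAt_id y).sub_const z.2.1)).const_add _).fderiv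

lemma isGraphAt_graphOf (c : Isom n) (z : JetCoord n) :
    IsGraphAt c (graphOf c z).S (graphOf c z).p (taylor z) :=
  ⟨contDiff_taylor z, Filter.Eventually.of_forall fun _ => Iff.rfl⟩

lemma xcoord_graphOf (c : Isom n) (z : JetCoord n) : xcoord c (graphOf c z).p = z.2.1 :=
  xcoord_symm_join c _ _

lemma isConormal_jetWithCoord (c : Isom n) (z : JetCoord n) :
    IsConormal (jetWithCoord c z).proj ξ ↔ ξ ≠ 0 ∧ ∀ v, ξ (liftVec c z.2.2.1 v) = 0 := by
  rw [show (jetWithCoord c z).proj = jet 1 (graphOf c z) from rfl, isConormal_jet,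
    (isGraphAt_graphOf c z).isConormal_iff, xcoord_graphOf, fderiv_taylor]

lemma isSFF_jetWithCoord (c : Isom n) (u : ℝ) (x : Euc n) (d : Euc n →L[ℝ] ℝ)
    (b : SymBil (Euc n)) (hξ : ξ ≠ 0) (hd : ∀ v, ξ (liftVec c d v) = 0) (β : SymBil (Hyp ξ)) :
    IsSFF (jetWithCoord c (u, x, d, b)) ξ β ↔
      ξ (upVec c) • pullbackEquiv (hypEquiv c d hξ hd) b = β := by
  have hX : (graphOf c (u, x, d, b)).IsConormal ξ :=
    isConormal_jet.1 ((isConormal_jetWithCoord c _).2 ⟨hξ, hd⟩)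
  rw [show jetWithCoord c (u, x, d, b) = jet 2 (graphOf c (u, x, d, b)) from rfl, isSFF_jet hX]
  refine (isGraphAt_graphOf c _).isSFF_iff_eq ?_ (hess_taylor _ _) hξ hd β
  rw [xcoord_graphOf, fderiv_taylor]

/-- Euclidean coordinates adapted to a unit covector. -/
lemma exists_adapted_isom (hξ : ‖ξ‖ = 1) : ∃ c : Isom n, ξ = graphCovector c 0 := by
  set N := (InnerProductSpace.toDual ℝ (Euc (n + 1))).symm ξ with hN
  have hNn : ‖N‖ = ‖join (1 : ℝ) (0 : Euc n)‖ := by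
    rw [hN, LinearIsometryEquiv.norm_map, hξ, eq_comm, ← sq_eq_sq₀ (norm_nonneg _) zero_le_one,
      ← real_inner_self_eq_norm_sq, inner_join]
    simp
  -- The reflection exchanging the unit normal with the vector of the `u`-axis; it is the identity
  -- when they coincide. Coordinate systems need not preserve orientation.
  set L := (ℝ ∙ (N - join 1 0))ᗮ.reflection with hL
  have hLN : L N = join 1 0 := Submodule.reflection_sub hNn
  refine ⟨L.toAffineIsometryEquiv, ?_⟩
  ext w
  rw [graphCovector_apply]
  show ξ w = (L w) 0 - 0
  have h1 : ξ w = inner ℝ N w := (InnerProductSpace.toDual_symm_apply).symm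
  have h2 : inner ℝ (join (1 : ℝ) (0 : Euc n)) (L w) = (L w) 0 := by
    conv_lhs => rw [← join_tail (L w), inner_join]
    simp
  rw [h1, ← L.inner_map_map, hLN, h2, sub_zero]

/-- In coordinates adapted to `ξ` the tangent plane is horizontal and `ξ(∂_u) = 1`, so the graph of
the quadratic polynomial with Hessian `β` has the required form. -/
lemma exists_jet_two (p : Euc (n + 1)) (hξ : ‖ξ‖ = 1) (β : SymBil (Hyp ξ)) :
    ∃ a : Jet n 2, a.base = p ∧ IsUnitConormal a.proj ξ ∧ IsSFF a ξ β := by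
  obtain ⟨c, hc⟩ := exists_adapted_isom hξ
  have h0 : ξ ≠ 0 := by
    rw [hc]
    exact graphCovector_ne_zero c 0
  have hd : ∀ v, ξ (liftVec c 0 v) = 0 := by
    rw [hc]
    exact graphCovector_liftVec c 0
  have hu : ξ (upVec c) = 1 := by
    rw [hc, graphCovector_upVec]
  set b := (pullbackEquiv (hypEquiv c 0 h0 hd)).symm β with hb
  refine ⟨jetWithCoord c (ucoord c p, xcoord c p, 0, b),
    symm_join_coord c p, ⟨(isConormal_jetWithCoord c _).2 ⟨h0, hd⟩, hξ⟩, ?_⟩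
  refine (isSFF_jetWithCoord c _ _ 0 b h0 hd β).2 ?_
  rw [hu, one_smul, hb, ContinuousLinearEquiv.apply_symm_apply]

/-- `J¹ ≃ ℙ T*𝔼ⁿ⁺¹`. -/
lemma exists_equiv_projectivization :
    ∃ Θ : Jet n 1 ≃ Euc (n + 1) × Projectivization ℝ (Covector n),
      ∀ a : Jet n 1, (Θ a).1 = a.base ∧
        ∀ (ξ : Covector n) (hξ : ξ ≠ 0),
          IsConormal a ξ ↔ (Θ a).2 = Projectivization.mk ℝ ξ hξ := by
  choose ν hν using exists_isConormal (n := n)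
  set T : Jet n 1 → Euc (n + 1) × Projectivization ℝ (Covector n) := fun a =>
    (a.base, Projectivization.mk ℝ (ν a) (hν a).ne_zero) with hT
  have key : ∀ (a : Jet n 1) (ξ : Covector n) (hξ : ξ ≠ 0),
      IsConormal a ξ ↔ (T a).2 = Projectivization.mk ℝ ξ hξ := by
    intro a ξ hξ
    rw [hT, Projectivization.mk_eq_mk_iff']
    constructor
    · intro h
      obtain ⟨r, -, h⟩ := h.exists_smul (hν a)
      exact ⟨r, h.symm⟩
    · rintro ⟨r, hr⟩
      have hr0 : r ≠ 0 := by
        rintro rfl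
        exact (hν a).ne_zero (by rw [← hr, zero_smul])
      have := (hν a).smul (inv_ne_zero hr0)
      rwa [← hr, smul_smul, inv_mul_cancel₀ hr0, one_smul] at this
  have hbij : Function.Bijective T := by
    constructor
    · intro a b h
      exact Jet.ext_one (congrArg Prod.fst h) (hν a)
        ((key b _ (hν a).ne_zero).2 (congrArg Prod.snd h).symm)
    · rintro ⟨p, l⟩
      induction l using Projectivization.ind with
      | h ξ hξ =>
        have h0 : ‖ξ‖ ≠ 0 := norm_ne_zero_iff.2 hξ
        have h1 : ‖‖ξ‖⁻¹ • ξ‖ = 1 := by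
          rw [norm_smul, norm_inv, norm_norm, inv_mul_cancel₀ h0]
        obtain ⟨a, ha, ha', -⟩ := exists_jet_two p h1 0
        refine ⟨a.proj, Prod.ext (a.base_proj.trans ha) ((key _ ξ hξ).1 ?_)⟩
        have := ha'.1.smul h0
        rwa [smul_smul, mul_inv_cancel₀ h0, one_smul] at this
  exact ⟨Equiv.ofBijective T hbij, fun a => ⟨rfl, key a⟩⟩

/-- The fibre of `J² → J¹` is identified with the symmetric forms by the second fundamental
form. -/
lemma exists_fibre_equiv {a₁ : Jet n 1} (hξ : IsUnitConormal a₁ ξ) :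
    ∃ ι : Fibre a₁ ≃ SymBil (Hyp ξ),
      ∀ (a : Fibre a₁) (β : SymBil (Hyp ξ)), IsSFF a.1 ξ β ↔ ι a = β := by
  have hc : ∀ a : Fibre a₁, IsConormal a.1.proj ξ := fun a => by
    rw [a.2]
    exact hξ.1
  choose s hs hs' using fun a : Fibre a₁ => (hc a).existsUnique_isSFF
  have key : ∀ (a : Fibre a₁) (β : SymBil (Hyp ξ)), IsSFF a.1 ξ β ↔ s a = β := fun a β =>
    ⟨fun h => (hs' a β h).symm, fun h => h ▸ hs a⟩
  refine ⟨Equiv.ofBijective s ⟨fun a b h => ?_, fun β => ?_⟩, key⟩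
  · refine Subtype.ext (Jet.ext_two ?_ (hc a) (hc b) (hs a) ((key b _).2 h.symm))
    rw [← Jet.base_proj, ← Jet.base_proj, a.2, b.2]
  · obtain ⟨a, ha, ha', haβ⟩ := exists_jet_two a₁.base hξ.2 β
    have : a.proj = a₁ := Jet.ext_one (a.base_proj.trans ha) ha'.1 hξ.1
    exact ⟨⟨a, this⟩, (key ⟨a, this⟩ β).1 haβ⟩

/-- The identification of the fibre is linear in the second-order jet coordinates. -/
lemma exists_linear_coord {a₁ : Jet n 1} (hξ : IsUnitConormal a₁ ξ)
    {ι : Fibre a₁ ≃ SymBil (Hyp ξ)}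
    (hι : ∀ (a : Fibre a₁) (β : SymBil (Hyp ξ)), IsSFF a.1 ξ β ↔ ι a = β)
    (c : Isom n) (u : ℝ) (x : Euc n) (d : Euc n →L[ℝ] ℝ)
    (h : ∀ b, (jetWithCoord c (u, x, d, b)).proj = a₁) :
    ∃ L : SymBil (Euc n) ≃L[ℝ] SymBil (Hyp ξ),
      ∀ b, ι ⟨jetWithCoord c (u, x, d, b), h b⟩ = L b := by
  have h1 : IsConormal (jetWithCoord c (u, x, d, 0)).proj ξ := by
    rw [h]
    exact hξ.1
  obtain ⟨h0, hd⟩ := (isConormal_jetWithCoord c _).1 h1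
  have hu := upVec_ne_zero_of_liftVec h0 hd
  refine ⟨(pullbackEquiv (hypEquiv c d h0 hd)).trans
    (ContinuousLinearEquiv.smulLeft (Units.mk0 _ hu)), fun b => ?_⟩
  exact (hι _ _).1 ((isSFF_jetWithCoord c u x d b h0 hd _).2 rfl)

end JetLevel

/-! ### Motions -/

section Motions

variable {n : ℕ} {ξ η : Covector n}

/-- The isometry of hyperplanes induced by an isometry. -/
def hypIsom (L : Euc (n + 1) ≃ₗᵢ[ℝ] Euc (n + 1)) (h : ∀ w, η (L w) = 0 ↔ ξ w = 0) :
    Hyp ξ ≃ₗᵢ[ℝ] Hyp η where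
  toFun w := ⟨L w, (h w).2 w.2⟩
  map_add' v w := Subtype.ext (L.map_add v w)
  map_smul' r v := Subtype.ext (L.map_smul r (v : Euc (n + 1)))
  invFun w := ⟨L.symm w, (h _).1 (by
    rw [L.apply_symm_apply]
    exact w.2)⟩
  left_inv w := Subtype.ext (L.symm_apply_apply w)
  right_inv w := Subtype.ext (L.apply_symm_apply w)
  norm_map' w := L.norm_map w

lemma iteratedDeriv_two_isom_comp (g : Isom n) {γ : ℝ → Euc (n + 1)} (h : ContDiff ℝ ∞ γ) :
    iteratedDeriv 2 (fun t => g (γ t)) 0 = g.linearIsometryEquiv (iteratedDeriv 2 γ 0) := by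
  have h1 : deriv (fun t => g (γ t)) = fun t => g.linearIsometryEquiv (deriv γ t) :=
    funext fun t => deriv_isom_comp g h t
  have hdd : HasDerivAt (deriv γ) (deriv (deriv γ) 0) 0 :=
    (((contDiff_infty_iff_deriv.1 h).2.differentiable (by simp)) 0).hasDerivAt
  rw [iteratedDeriv_succ, iteratedDeriv_one, iteratedDeriv_succ, iteratedDeriv_one, h1]
  exact (g.linearIsometryEquiv.toContinuousLinearEquiv.hasFDerivAt.comp_hasDerivAt 0 hdd).deriv

/-- Curves in the moved hypersurface pull back to curves in the original one, and velocity and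
acceleration are both transformed by the linear part of `g`. -/
lemma PointedHypersurface.IsSFF.move {X : PointedHypersurface n} {β : SymBil (Hyp ξ)}
    (h : X.IsSFF ξ β) (g : Isom n) (hη : ∀ w, η (g.linearIsometryEquiv w) = ξ w)
    {β' : SymBil (Hyp η)} (hβ' : ∀ (v : Hyp ξ) (v' : Hyp η),
      (v' : Euc (n + 1)) = g.linearIsometryEquiv v → β'.1 v' v' = β.1 v v) :
    (X.move g).IsSFF η β' := by
  intro γ hγ v' hv'
  have hγ' := isCurve_of_move hγ
  have hlin : ∀ w, g.linearIsometryEquiv (g.symm.linearIsometryEquiv w) = w := fun w =>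
    g.linearIsometryEquiv.apply_symm_apply w
  have hξ : ∀ w, ξ (g.symm.linearIsometryEquiv w) = η w := fun w => by rw [← hη, hlin]
  have hd := deriv_isom_comp g.symm hγ.1 0
  have hv : ξ (deriv (fun t => g.symm (γ t)) 0) = 0 := by
    rw [hd, hξ, ← hv']
    exact v'.2
  rw [hβ' ⟨_, hv⟩ v' (by rw [hv']; show _ = g.linearIsometryEquiv (deriv _ 0); rw [hd, hlin]),
    h _ hγ' ⟨_, hv⟩ rfl, iteratedDeriv_two_isom_comp g.symm hγ.1, hξ]

lemma IsSFF.move {a : Jet n 2} {β : SymBil (Hyp ξ)}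
    (h : IsSFF a ξ β) (g : Isom n) (hη : ∀ w, η (g.linearIsometryEquiv w) = ξ w)
    {β' : SymBil (Hyp η)} (hβ' : ∀ (v : Hyp ξ) (v' : Hyp η),
      (v' : Euc (n + 1)) = g.linearIsometryEquiv v → β'.1 v' v' = β.1 v v) :
    IsSFF (a.move g) η β' := by
  obtain ⟨X, rfl, hX⟩ := h
  exact ⟨X.move g, rfl, hX.move g hη hβ'⟩

/-- Reversing the conormal negates the normal acceleration. The new form lives on `Hyp (-ξ)`, a
different type, so it is compared with `-β` through the underlying vectors. -/
lemma PointedHypersurface.IsSFF.neg {X : PointedHypersurface n} {β : SymBil (Hyp ξ)}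
    (h : X.IsSFF ξ β) {β' : SymBil (Hyp (-ξ))} (hβ' : ∀ (v : Hyp ξ) (v' : Hyp (-ξ)),
      (v' : Euc (n + 1)) = v → β'.1 v' v' = -β.1 v v) : X.IsSFF (-ξ) β' := by
  intro γ hγ v' hv'
  have hv : ξ (v' : Euc (n + 1)) = 0 := neg_eq_zero.1 v'.2
  rw [hβ' ⟨_, hv⟩ v' rfl, h γ hγ ⟨_, hv⟩ hv']
  rfl

lemma base_move (g : Isom n) (a : Jet n 2) : (a.move g).base = g a.base := by
  induction a using Quot.ind
  rfl

/-- An isometry of hyperplanes extends to Euclidean space, respecting unit conormals. -/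
lemma exists_isometry_extension (hξ : ‖ξ‖ = 1) (hη : ‖η‖ = 1) (B : Hyp ξ ≃ₗᵢ[ℝ] Hyp η) :
    ∃ L : Euc (n + 1) ≃ₗᵢ[ℝ] Euc (n + 1), (∀ w, η (L w) = ξ w) ∧
      ∀ w : Hyp ξ, L w = B w := by
  set N := (InnerProductSpace.toDual ℝ (Euc (n + 1))).symm ξ with hN
  set N' := (InnerProductSpace.toDual ℝ (Euc (n + 1))).symm η with hN'
  have hNi : ∀ w, inner ℝ N w = ξ w := fun w => InnerProductSpace.toDual_symm_apply
  have hNi' : ∀ w, inner ℝ N' w = η w := fun w => InnerProductSpace.toDual_symm_apply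
  have hNn : ‖N‖ = 1 := by rw [hN, LinearIsometryEquiv.norm_map, hξ]
  have hNn' : ‖N'‖ = 1 := by rw [hN', LinearIsometryEquiv.norm_map, hη]
  have hξN : ξ N = 1 := by rw [← hNi, real_inner_self_eq_norm_sq, hNn, one_pow]
  have hηN : η N' = 1 := by rw [← hNi', real_inner_self_eq_norm_sq, hNn', one_pow]
  let P : Euc (n + 1) →ₗ[ℝ] Hyp ξ :=
    LinearMap.codRestrict _ (LinearMap.id - (ξ : Euc (n + 1) →ₗ[ℝ] ℝ).smulRight N) fun w => by
      show ξ (w - ξ w • N) = 0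
      rw [map_sub, map_smul, hξN, smul_eq_mul, mul_one, sub_self]
  have hP : ∀ w, (P w : Euc (n + 1)) = w - ξ w • N := fun w => rfl
  -- The orthogonal sum of `N ↦ N'` and `B`; Pythagoras on both sides shows that it preserves norms.
  let L₀ : Euc (n + 1) →ₗ[ℝ] Euc (n + 1) :=
    (ξ : Euc (n + 1) →ₗ[ℝ] ℝ).smulRight N' +
      (Hyp η).subtype ∘ₗ (B.toLinearEquiv : Hyp ξ →ₗ[ℝ] Hyp η) ∘ₗ P
  have hL : ∀ w, L₀ w = ξ w • N' + (B (P w) : Euc (n + 1)) := fun w => rfl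
  have hBη : ∀ v : Hyp ξ, η (B v : Euc (n + 1)) = 0 := fun v => (B v).2
  have hsq : ∀ w, ‖L₀ w‖ = ‖w‖ := by
    intro w
    have h1 : ‖L₀ w‖ ^ 2 = ξ w ^ 2 + ‖P w‖ ^ 2 := by
      have h0 : ‖(B (P w) : Euc (n + 1))‖ = ‖P w‖ := B.norm_map _
      rw [hL, norm_add_sq_real, real_inner_smul_left, hNi', hBη, norm_smul, hNn', h0]
      simp
    have h2 : ‖w‖ ^ 2 = ξ w ^ 2 + ‖P w‖ ^ 2 := by
      have h3 : ξ (P w : Euc (n + 1)) = 0 := (P w).2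
      have h4 : w = ξ w • N + (P w : Euc (n + 1)) := by rw [hP]; abel
      conv_lhs => rw [h4, norm_add_sq_real, real_inner_smul_left, hNi, h3, norm_smul, hNn]
      simp
    rw [← sq_eq_sq₀ (norm_nonneg _) (norm_nonneg _), h1, h2]
  let L : Euc (n + 1) ≃ₗᵢ[ℝ] Euc (n + 1) :=
    LinearIsometry.toLinearIsometryEquiv ⟨L₀, hsq⟩ rfl
  have hLL : ∀ w, L w = L₀ w := fun w => rfl
  refine ⟨L, fun w => ?_, fun w => ?_⟩
  · rw [hLL, hL, map_add, map_smul, hηN, hBη, smul_eq_mul, mul_one, add_zero]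
  · have h1 : ξ (w : Euc (n + 1)) = 0 := w.2
    have h2 : P w = w := Subtype.ext (by rw [hP, h1, zero_smul, sub_zero])
    rw [hLL, hL, h1, h2, zero_smul, zero_add]

/-- A symmetric form on a hyperplane is preserved by a reflection fixing the unit conormal. -/
lemma exists_reflection (hn : 1 ≤ n) (hξ : ξ ≠ 0) (β : SymBil (Hyp ξ)) :
    ∃ H : Euc (n + 1) ≃ₗᵢ[ℝ] Euc (n + 1),
      LinearMap.det (H.toLinearEquiv : Euc (n + 1) →ₗ[ℝ] Euc (n + 1)) = -1 ∧
      (∀ w, ξ (H w) = ξ w) ∧ ∀ v : Hyp ξ, ∃ v' : Hyp ξ,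
      (v' : Euc (n + 1)) = H v ∧ β.1 v' v' = β.1 v v := by
  obtain ⟨e, μ, he, hμ⟩ := exists_eigenvector (by rw [finrank_hyp hξ]; exact hn) β
  have he' : ‖(e : Euc (n + 1))‖ = 1 := he
  have hξe : ξ (e : Euc (n + 1)) = 0 := e.2
  -- The eigenvector `e` is tangent, so the reflection along it in the whole space leaves `ξ`
  -- unchanged.
  refine ⟨(ℝ ∙ (e : Euc (n + 1)))ᗮ.reflection, det_reflection_orthogonal_unit he', fun w => ?_,
    fun v => ⟨v - (2 * inner ℝ e v) • e, (reflection_orthogonal_unit_apply he' _).symm,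
      apply_reflect_eigenvector he hμ v v⟩⟩
  rw [reflection_orthogonal_unit_apply he', map_sub, map_smul, hξe, smul_zero, sub_zero]

/-- Symmetric forms on hyperplanes with the same invariants are related by a rotation which
respects the unit conormals. -/
lemma exists_rotation (hn : 1 ≤ n) (hξ : ‖ξ‖ = 1) (hη : ‖η‖ = 1) {β : SymBil (Hyp ξ)}
    {β' : SymBil (Hyp η)} (h : sigma β = sigma β') :
    ∃ L : Euc (n + 1) ≃ₗᵢ[ℝ] Euc (n + 1),
      LinearMap.det (L.toLinearEquiv : Euc (n + 1) →ₗ[ℝ] Euc (n + 1)) = 1 ∧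
      (∀ w, η (L w) = ξ w) ∧ ∀ (v : Hyp ξ) (v' : Hyp η),
      (v' : Euc (n + 1)) = L v → β'.1 v' v' = β.1 v v := by
  have hξ0 : ξ ≠ 0 := by
    rintro rfl
    simp at hξ
  have hη0 : η ≠ 0 := by
    rintro rfl
    simp at hη
  obtain ⟨B, hB⟩ := exists_pullback_of_sigmaOf_eq (finrank_hyp hξ0) (finrank_hyp hη0) h
  obtain ⟨L, hL1, hL2⟩ := exists_isometry_extension hξ hη B
  have hβ : ∀ (v : Hyp ξ) (v' : Hyp η), (v' : Euc (n + 1)) = L v → β'.1 v' v' = β.1 v v := by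
    intro v v' hv
    have : v' = B v := Subtype.ext (hv.trans (hL2 v))
    rw [this, ← hB]
    rfl
  by_cases hdet : LinearMap.det (L.toLinearEquiv : Euc (n + 1) →ₗ[ℝ] Euc (n + 1)) = 1
  · exact ⟨L, hdet, hL1, hβ⟩
  · have hdet' := (det_eq_one_or_neg_one L).resolve_left hdet
    obtain ⟨H, hH, hHξ, hHβ⟩ := exists_reflection hn hξ0 β
    refine ⟨H.trans L, ?_, fun w => ?_, fun v v' hv => ?_⟩
    · have h1 : ((H.trans L).toLinearEquiv : Euc (n + 1) →ₗ[ℝ] Euc (n + 1)) =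
          (L.toLinearEquiv : Euc (n + 1) →ₗ[ℝ] Euc (n + 1)) ∘ₗ
            (H.toLinearEquiv : Euc (n + 1) →ₗ[ℝ] Euc (n + 1)) := rfl
      rw [h1, LinearMap.det_comp, hH, hdet']
      norm_num
    · rw [LinearIsometryEquiv.trans_apply, hL1, hHξ]
    · obtain ⟨u, hu, huβ⟩ := hHβ v
      rw [LinearIsometryEquiv.trans_apply, ← hu] at hv
      rw [hβ u v' hv, huβ]

/-- The motion with linear part `L` taking `p` to `q`. -/
lemma exists_isom (L : Euc (n + 1) ≃ₗᵢ[ℝ] Euc (n + 1)) (p q : Euc (n + 1)) :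
    ∃ g : Isom n, g.linearIsometryEquiv = L ∧ g p = q := by
  refine ⟨AffineIsometryEquiv.mk' (fun x => L (x - p) + q) L p fun x => ?_, ?_, ?_⟩
  · simp
  · rfl
  · show L (p - p) + q = q
    simp

end Motions

/-! ### Invariants of cooriented jets -/

namespace CoJet

variable {n : ℕ}

/-- The second fundamental form of a cooriented jet. -/
def sff (a : CoJet n) : SymBil (Hyp a.conormal) :=
  a.isUnitConormal.1.existsUnique_isSFF.choose

lemma isSFF_sff (a : CoJet n) : IsSFF a.jet a.conormal a.sff :=
  a.isUnitConormal.1.existsUnique_isSFF.choose_spec.1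

lemma sff_eq {a : CoJet n} {β : SymBil (Hyp a.conormal)} (h : IsSFF a.jet a.conormal β) :
    a.sff = β :=
  (a.isUnitConormal.1.existsUnique_isSFF.choose_spec.2 β h).symm

/-- The elementary symmetric functions of the principal curvatures. -/
def sigmaHat (a : CoJet n) : Fin n → ℝ := sigma a.sff

lemma sigmaHat_eq {a : CoJet n} {β : SymBil (Hyp a.conormal)}
    (h : IsSFF a.jet a.conormal β) : a.sigmaHat = sigma β := by
  rw [sigmaHat, sff_eq h]

lemma ext_isSFF {a b : CoJet n} (hb : a.jet.base = b.jet.base) (hc : b.conormal = a.conormal)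
    (h : IsSFF b.jet a.conormal a.sff) : a = b := by
  have hj : a.jet = b.jet := by
    refine Jet.ext_two hb a.isUnitConormal.1 ?_ a.isSFF_sff h
    rw [← hc]
    exact b.isUnitConormal.1
  cases a
  cases b
  simp only at hj hc
  subst hj hc
  rfl

/-- The linear part of `g` restricts to an isometry of tangent hyperplanes carrying one second
fundamental form to the other. Nothing here requires `g` to preserve orientation. -/
lemma sigmaHat_move (g : Isom n) (a : CoJet n) : (a.move g).sigmaHat = a.sigmaHat := by
  have hη : ∀ w, (a.move g).conormal (g.linearIsometryEquiv w) = a.conormal w := fun w => by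
    show a.conormal (g.linearIsometryEquiv.symm (g.linearIsometryEquiv w)) = _
    rw [LinearIsometryEquiv.symm_apply_apply]
  set B := hypIsom (ξ := a.conormal) (η := (a.move g).conormal) g.linearIsometryEquiv
    (fun w => by rw [hη])
  obtain ⟨β', hβ'⟩ := (pullbackEquiv B.toContinuousLinearEquiv).surjective a.sff
  have h : IsSFF (a.move g).jet (a.move g).conormal β' := by
    refine a.isSFF_sff.move g hη fun v v' hv => ?_
    have : v' = B v := Subtype.ext hv
    rw [this, ← hβ']
    rfl
  rw [sigmaHat_eq h, sigmaHat, ← hβ', sigma_eq_sigmaOf, sigma_eq_sigmaOf, sigmaOf_pullback]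

/-- The invariants separate the orbits of `SE(n+1)`. -/
lemma exists_move_eq (hn : 1 ≤ n) {a b : CoJet n} (h : a.sigmaHat = b.sigmaHat) :
    ∃ g ∈ SE n, a.move g = b := by
  obtain ⟨L, hdet, hL, hβ⟩ := exists_rotation hn a.isUnitConormal.2 b.isUnitConormal.2 h
  obtain ⟨g, hg, hgp⟩ := exists_isom L a.jet.base b.jet.base
  subst hg
  refine ⟨g, hdet, (ext_isSFF ?_ ?_ ?_).symm⟩
  · exact ((base_move g a.jet).trans hgp).symm
  · ext w
    show a.conormal (g.linearIsometryEquiv.symm w) = b.conormal w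
    rw [← hL, LinearIsometryEquiv.apply_symm_apply]
  · exact a.isSFF_sff.move g hL hβ

/-- The same jet with the opposite coorientation. -/
def flip (a : CoJet n) : CoJet n := ⟨a.jet, -a.conormal, a.isUnitConormal.neg⟩

/-- The identity of the ambient space is an isometry between `ker ξ` and `ker (-ξ)`, and under it
the second fundamental form changes sign. -/
lemma sigmaHat_flip (a : CoJet n) : a.flip.sigmaHat = signFlip a.sigmaHat := by
  set B := hypIsom (ξ := a.conormal) (η := a.flip.conormal) (LinearIsometryEquiv.refl ℝ _)
    (fun w => neg_eq_zero)
  obtain ⟨β', hβ'⟩ := (pullbackEquiv B.toContinuousLinearEquiv).surjective (-a.sff)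
  have h : IsSFF a.flip.jet a.flip.conormal β' := by
    obtain ⟨X, hX, h⟩ := a.isSFF_sff
    refine ⟨X, hX, h.neg fun v v' hv => ?_⟩
    have h1 : v' = B v := Subtype.ext hv
    have h2 : (pullbackEquiv B.toContinuousLinearEquiv β').1 v v = (-a.sff).1 v v := by rw [hβ']
    rw [h1]
    exact h2
  rw [sigmaHat_eq h, sigma_eq_sigmaOf, ← sigmaOf_pullback n B, hβ',
    sigmaOf_neg (finrank_hyp a.isUnitConormal.ne_zero)]
  rfl

lemma eq_or_eq_flip {a b : CoJet n} (h : a.jet = b.jet) : b = a ∨ b = a.flip := by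
  obtain ⟨j, ξ, hξ⟩ := a
  obtain ⟨k, η, hη⟩ := b
  simp only at h
  subst h
  rcases hξ.eq_or_eq_neg hη with rfl | rfl
  · exact Or.inl rfl
  · exact Or.inr rfl

lemma exists_jet_eq (j : Jet n 2) : ∃ a : CoJet n, a.jet = j := by
  obtain ⟨ξ, h⟩ := exists_isUnitConormal j.proj
  exact ⟨⟨j, ξ, h⟩, rfl⟩

end CoJet

/-! ### Normal forms of jets in coordinates -/

section NormalForm

variable {n : ℕ}

/-- The gradient vector of a differential. -/
def sharp : (Euc n →L[ℝ] ℝ) →L[ℝ] Euc n :=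
  LinearMap.toContinuousLinearMap
    { toFun := fun d => (InnerProductSpace.toDual ℝ (Euc n)).symm d
      map_add' := fun v w => map_add _ _ _
      map_smul' := fun r v => by
        rw [map_smulₛₗ]
        rfl }

lemma inner_sharp (d : Euc n →L[ℝ] ℝ) (v : Euc n) : inner ℝ (sharp d) v = d v :=
  InnerProductSpace.toDual_symm_apply

lemma apply_sharp_nonneg (d : Euc n →L[ℝ] ℝ) : 0 ≤ d (sharp d) := by
  rw [← inner_sharp]
  exact real_inner_self_nonneg

/-- The length `(1 + |d|²)^(1/2)` of the covector `du - d`. -/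
def slope (d : Euc n →L[ℝ] ℝ) : ℝ := Real.sqrt (1 + d (sharp d))

lemma slope_pos (d : Euc n →L[ℝ] ℝ) : 0 < slope d :=
  Real.sqrt_pos.2 (by linarith [apply_sharp_nonneg d])

lemma slope_sq (d : Euc n →L[ℝ] ℝ) : d (sharp d) = slope d ^ 2 - 1 := by
  rw [slope, Real.sq_sqrt (by linarith [apply_sharp_nonneg d])]
  ring

lemma contDiff_slope : ContDiff ℝ ∞ (slope : (Euc n →L[ℝ] ℝ) → ℝ) := by
  refine ContDiff.sqrt (contDiff_const.add (contDiff_id.clm_apply sharp.contDiff)) fun d => ?_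
  show 1 + d (sharp d) ≠ 0
  linarith [apply_sharp_nonneg d]

@[simp] lemma slope_zero : slope (0 : Euc n →L[ℝ] ℝ) = 1 := by
  simp [slope]

/-- The inverse square root of the metric `1 + d ⊗ d` induced on a graph. -/
def frame (d : Euc n →L[ℝ] ℝ) : Euc n →L[ℝ] Euc n :=
  ContinuousLinearMap.id ℝ _ - (slope d * (slope d + 1))⁻¹ • d.smulRight (sharp d)

lemma frame_apply (d : Euc n →L[ℝ] ℝ) (v : Euc n) :
    frame d v = v - ((slope d * (slope d + 1))⁻¹ * d v) • sharp d := by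
  simp [frame, mul_smul]

/-- The inverse of `frame`. -/
def coframe (d : Euc n →L[ℝ] ℝ) : Euc n →L[ℝ] Euc n :=
  ContinuousLinearMap.id ℝ _ + (slope d + 1)⁻¹ • d.smulRight (sharp d)

lemma coframe_apply (d : Euc n →L[ℝ] ℝ) (v : Euc n) :
    coframe d v = v + ((slope d + 1)⁻¹ * d v) • sharp d := by
  simp [coframe, mul_smul]

lemma apply_frame (d : Euc n →L[ℝ] ℝ) (v : Euc n) : d (frame d v) = (slope d)⁻¹ * d v := by
  have h := slope_pos d
  rw [frame_apply, map_sub, map_smul, slope_sq, smul_eq_mul]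
  field_simp
  ring

lemma coframe_frame (d : Euc n →L[ℝ] ℝ) (v : Euc n) : coframe d (frame d v) = v := by
  have h := slope_pos d
  rw [coframe_apply, apply_frame, frame_apply, sub_add, ← sub_smul]
  have : (slope d * (slope d + 1))⁻¹ * d v - (slope d + 1)⁻¹ * ((slope d)⁻¹ * d v) = 0 := by
    field_simp
    ring
  rw [this, zero_smul, sub_zero]

/-- The left side is the squared length of the lift of `frame d v` to the tangent space of a graph
with gradient `d`, so `frame` followed by the lift is isometric. -/
lemma norm_frame_sq (d : Euc n →L[ℝ] ℝ) (v : Euc n) :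
    d (frame d v) ^ 2 + ‖frame d v‖ ^ 2 = ‖v‖ ^ 2 := by
  have h := slope_pos d
  have hs : ‖sharp d‖ ^ 2 = slope d ^ 2 - 1 := by
    rw [← slope_sq, ← inner_sharp, real_inner_self_eq_norm_sq]
  rw [apply_frame, frame_apply, norm_sub_sq_real, real_inner_smul_right, real_inner_comm,
    inner_sharp, norm_smul, mul_pow ‖(slope d * (slope d + 1))⁻¹ * d v‖, hs, Real.norm_eq_abs, sq_abs]
  field_simp
  ring

/-- The second fundamental form of a graph in an orthonormal frame of its tangent space. -/
def normalForm (z : JetCoord n) : SymBil (Euc n) :=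
  (slope z.2.2.1)⁻¹ • pullback (frame z.2.2.1) z.2.2.2

/-- The second-order coordinates of the graph with gradient `d` and the given normal form. -/
def ofNormalForm (b : SymBil (Euc n)) (d : Euc n →L[ℝ] ℝ) : SymBil (Euc n) :=
  slope d • pullback (coframe d) b

/-- For fixed `b` this provides a smooth section over the 1-jet coordinates along which the normal
form is constant. -/
lemma normalForm_ofNormalForm (u : ℝ) (x : Euc n) (d : Euc n →L[ℝ] ℝ) (b : SymBil (Euc n)) :
    normalForm (u, x, d, ofNormalForm b d) = b := by
  have h := slope_pos d
  refine SymBil.ext_apply fun v w => ?_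
  show (slope d)⁻¹ * (slope d * b.1 (coframe d (frame d v)) (coframe d (frame d w))) = _
  rw [coframe_frame, coframe_frame, inv_mul_cancel_left₀ h.ne']

lemma ofNormalForm_zero (b : SymBil (Euc n)) : ofNormalForm b 0 = b := by
  refine SymBil.ext_apply fun v w => ?_
  show slope 0 * b.1 (coframe 0 v) (coframe 0 w) = _
  simp [coframe_apply]

/-- A linear left inverse of the inclusion reduces the claim to all bilinear maps, where in finite
dimension smoothness can be tested on vectors. -/
lemma contDiff_symBil {E W : Type*} [NormedAddCommGroup E] [NormedSpace ℝ E]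
    [NormedAddCommGroup W] [InnerProductSpace ℝ W] [FiniteDimensional ℝ W] {G : E → SymBil W}
    (h : ∀ v w, ContDiff ℝ ∞ fun x => (G x).1 v w) : ContDiff ℝ ∞ G := by
  obtain ⟨P, hP⟩ := (SymBil W).subtype.exists_leftInverse_of_injective
    (Submodule.ker_subtype _)
  have h1 : ContDiff ℝ ∞ fun x => (G x).1 :=
    contDiff_clm_apply_iff.2 fun v => contDiff_clm_apply_iff.2 fun w => h v w
  have h2 : G = fun x => P (G x).1 := funext fun x => (LinearMap.congr_fun hP (G x)).symm
  rw [h2]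
  exact (LinearMap.toContinuousLinearMap P).contDiff.comp h1

lemma contDiff_frame_apply (v : Euc n) :
    ContDiff ℝ ∞ fun d : Euc n →L[ℝ] ℝ => frame d v := by
  simp only [frame_apply]
  refine contDiff_const.sub (ContDiff.smul (ContDiff.mul (ContDiff.inv
    (contDiff_slope.mul (contDiff_slope.add contDiff_const)) fun d => ?_)
    (contDiff_id.clm_apply contDiff_const)) sharp.contDiff)
  have := slope_pos d
  positivity

lemma contDiff_coframe_apply (v : Euc n) :
    ContDiff ℝ ∞ fun d : Euc n →L[ℝ] ℝ => coframe d v := by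
  simp only [coframe_apply]
  refine contDiff_const.add (ContDiff.smul (ContDiff.mul (ContDiff.inv
    (contDiff_slope.add contDiff_const) fun d => ?_)
    (contDiff_id.clm_apply contDiff_const)) sharp.contDiff)
  have := slope_pos d
  positivity

lemma contDiff_normalForm : ContDiff ℝ ∞ (normalForm : JetCoord n → SymBil (Euc n)) := by
  refine contDiff_symBil fun v w => ?_
  have hd : ContDiff ℝ ∞ fun z : JetCoord n => z.2.2.1 := contDiff_snd.snd.fst
  have hb : ContDiff ℝ ∞ fun z : JetCoord n => z.2.2.2.1 :=
    (SymBil (Euc n)).subtypeL.contDiff.comp contDiff_snd.snd.snd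
  exact ((contDiff_slope.comp hd).inv fun z => (slope_pos _).ne').mul
    ((hb.clm_apply ((contDiff_frame_apply v).comp hd)).clm_apply
      ((contDiff_frame_apply w).comp hd))

lemma continuous_normalForm : Continuous (normalForm : JetCoord n → SymBil (Euc n)) :=
  contDiff_normalForm.continuous

lemma contDiff_ofNormalForm (b : SymBil (Euc n)) : ContDiff ℝ ∞ (ofNormalForm b) := by
  refine contDiff_symBil fun v w => ?_
  exact contDiff_slope.mul ((b.1.contDiff.comp (contDiff_coframe_apply v)).clm_apply
      (contDiff_coframe_apply w))

lemma norm_graphCovector (c : Isom n) (d : Euc n →L[ℝ] ℝ) : ‖graphCovector c d‖ = slope d := by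
  have h : graphCovector c d = InnerProductSpace.toDual ℝ (Euc (n + 1))
      (c.linearIsometryEquiv.symm (join 1 (-sharp d))) := by
    ext w
    rw [InnerProductSpace.toDual_apply_apply, ← c.linearIsometryEquiv.inner_map_map,
      LinearIsometryEquiv.apply_symm_apply, graphCovector_apply]
    conv_rhs => rw [← join_tail (c.linearIsometryEquiv w), inner_join, inner_neg_left, inner_sharp]
    ring
  rw [h, LinearIsometryEquiv.norm_map, LinearIsometryEquiv.norm_map,
    ← sq_eq_sq₀ (norm_nonneg _) (slope_pos d).le, ← real_inner_self_eq_norm_sq, inner_join,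
    inner_neg_neg, inner_sharp, slope_sq]
  ring

/-- The conormal is a multiple of `du - d`, whose length is `slope d`; unit length and the upward
orientation fix the factor. -/
lemma CoJet.HasCoord.conormal_eq {c : Isom n} {z : JetCoord n} {a : CoJet n}
    (h : CoJet.HasCoord c z a) : a.conormal (upVec c) = (slope z.2.2.1)⁻¹ ∧
      ∀ v, a.conormal (liftVec c z.2.2.1 v) = 0 := by
  have h1 := h.1
  have h2 : 0 < a.conormal (upVec c) := h.2
  have h3 := a.isUnitConormal.1
  rw [h1, isConormal_jetWithCoord] at h3
  refine ⟨?_, h3.2⟩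
  have h4 := a.isUnitConormal.2
  rw [eq_smul_graphCovector c _ h3.2, norm_smul, norm_graphCovector, Real.norm_eq_abs,
    abs_of_pos h2] at h4
  exact eq_inv_of_mul_eq_one_left h4

/-- The frame followed by the lift is an isometry `K` from `ℝⁿ` onto the tangent hyperplane, and it
pulls the second fundamental form back to the normal form. -/
lemma CoJet.HasCoord.sigmaHat_eq {c : Isom n} {z : JetCoord n} {a : CoJet n}
    (h : CoJet.HasCoord c z a) : a.sigmaHat = sigmaOf n (normalForm z) := by
  obtain ⟨hu, hd⟩ := h.conormal_eq
  have h0 := a.isUnitConormal.ne_zero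
  obtain ⟨u, x, d, b⟩ := z
  simp only at hu hd
  have hsff := (isSFF_jetWithCoord c u x d b h0 hd _).2 rfl
  rw [← h.1] at hsff
  let K₀ : Euc n →ₗᵢ[ℝ] Hyp a.conormal :=
    ⟨((hypEquiv c d h0 hd).symm.toLinearEquiv : Euc n →ₗ[ℝ] Hyp a.conormal) ∘ₗ
      (frame d : Euc n →ₗ[ℝ] Euc n), fun v => by
      show ‖liftVec c d (frame d v)‖ = ‖v‖
      rw [liftVec_apply, LinearIsometryEquiv.norm_map, ← sq_eq_sq₀ (norm_nonneg _) (norm_nonneg _),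
        ← real_inner_self_eq_norm_sq, inner_join, real_inner_self_eq_norm_sq, ← norm_frame_sq d v]
      ring⟩
  let K := K₀.toLinearIsometryEquiv (by
    rw [finrank_hyp h0, finrank_euclideanSpace_fin])
  have hK : ∀ v, hypEquiv c d h0 hd (K v) = frame d v := fun v =>
    (hypEquiv c d h0 hd).apply_symm_apply _
  rw [CoJet.sigmaHat_eq hsff, sigma_eq_sigmaOf, ← sigmaOf_pullback n K]
  congr 1
  refine SymBil.ext_apply fun v w => ?_
  show a.conormal (upVec c) * b.1 (hypEquiv c d h0 hd (K v)) (hypEquiv c d h0 hd (K w)) =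
    (slope d)⁻¹ * b.1 (frame d v) (frame d w)
  rw [hK, hK, hu]

lemma exists_coJet_hasCoord (c : Isom n) (z : JetCoord n) : ∃ a, CoJet.HasCoord c z a := by
  have hs := slope_pos z.2.2.1
  refine ⟨⟨jetWithCoord c z, (slope z.2.2.1)⁻¹ • graphCovector c z.2.2.1, ?_, ?_⟩, rfl, ?_⟩
  · exact ((isConormal_jetWithCoord c z).2 ⟨graphCovector_ne_zero _ _,
      graphCovector_liftVec _ _⟩).smul (inv_ne_zero hs.ne')
  · rw [norm_smul, norm_graphCovector, norm_inv, Real.norm_eq_abs, abs_of_pos hs,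
      inv_mul_cancel₀ hs.ne']
  · show 0 < (slope z.2.2.1)⁻¹ * graphCovector c z.2.2.1 (upVec c)
    rw [graphCovector_upVec, mul_one]
    exact inv_pos.2 hs

end NormalForm

/-! ### Invariant functions and invariant equations -/

section PDE

variable {n : ℕ}

lemma IsClosedHypersurface.preimage {W W' : Type*} [NormedAddCommGroup W] [NormedSpace ℝ W]
    [NormedAddCommGroup W'] [NormedSpace ℝ W'] (e : W ≃L[ℝ] W') {Z : Set W'}
    (hZ : IsClosedHypersurface Z) : IsClosedHypersurface (e ⁻¹' Z) := by
  refine ⟨hZ.1.preimage e.continuous, fun w hw => ?_⟩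
  obtain ⟨f, hf, hd, hz⟩ := hZ.2 (e w) hw
  refine ⟨f ∘ e, hf.comp e.contDiff, fun h => hd ?_, e.continuous.continuousAt.eventually hz⟩
  have h1 := ((hf.differentiable (by simp) (e w)).hasFDerivAt.comp w e.hasFDerivAt).fderiv
  rw [h] at h1
  ext v
  have := congrArg (fun T => T (e.symm v)) h1
  simpa using this.symm

lemma IsClosedHypersurface.preimage_symBil {W W' : Type*} [NormedAddCommGroup W]
    [NormedSpace ℝ W] [NormedAddCommGroup W'] [NormedSpace ℝ W']
    (e : SymBil W ≃L[ℝ] SymBil W') {Z : Set (SymBil W')} (hZ : IsClosedHypersurface Z) :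
    IsClosedHypersurface {β | e β ∈ Z} :=
  IsClosedHypersurface.preimage (W := SymBil W) (W' := SymBil W') e hZ

lemma contDiff_comp_symBil {W W' : Type*} [NormedAddCommGroup W]
    [NormedSpace ℝ W] [NormedAddCommGroup W'] [NormedSpace ℝ W']
    (e : SymBil W ≃L[ℝ] SymBil W') {F : SymBil W' → ℝ} (hF : ContDiff ℝ ∞ F) :
    ContDiff ℝ ∞ fun β => F (e β) :=
  ContDiff.comp (E := SymBil W) (F := SymBil W') hF
    (ContinuousLinearEquiv.contDiff (E := SymBil W) (F := SymBil W') e)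

variable {T : Type} {R : Isom n → JetCoord n → T → Prop} {F : SymBil (Euc n) → ℝ} {Fhat : T → ℝ}

lemma isSmoothOnJets_of_normalForm (hF : ContDiff ℝ ∞ F)
    (h : ∀ c z a, R c z a → Fhat a = F (normalForm z)) : IsSmoothOnJets R Fhat :=
  fun c => ⟨F ∘ normalForm, hF.comp contDiff_normalForm, h c⟩

lemma fderiv_eq_of_line {E E' : Type*} [NormedAddCommGroup E] [NormedSpace ℝ E]
    [NormedAddCommGroup E'] [NormedSpace ℝ E'] {G : E → ℝ} {H : E' → ℝ} {w v : E} {w' v' : E'}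
    (hG : DifferentiableAt ℝ G w) (hH : DifferentiableAt ℝ H w')
    (h : ∀ t : ℝ, G (w + t • v) = H (w' + t • v')) : fderiv ℝ G w v = fderiv ℝ H w' v' := by
  rw [← hG.lineDeriv_eq_fderiv, ← hH.lineDeriv_eq_fderiv]
  simp only [lineDeriv, h]

/-- With the 1-jet fixed, the normal form is linear in the second-order coordinates, with inverse
`ofNormalForm`. Hence every direction of normal forms is reached by moving along the fibre. -/
lemma normalForm_line (w : JetCoord n) (b : SymBil (Euc n)) (t : ℝ) :
    normalForm (w + t • (0, 0, 0, ofNormalForm b w.2.2.1)) = normalForm w + t • b := by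
  obtain ⟨u, x, d, b₀⟩ := w
  conv_rhs => rw [← normalForm_ofNormalForm u x d b]
  have h : ((u, x, d, b₀) : JetCoord n) + t • (0, 0, 0, ofNormalForm b d) =
      (u, x, d, b₀ + t • ofNormalForm b d) := by simp
  simp only [h]
  simp only [normalForm, map_add, map_smul, smul_add]
  rw [smul_comm]

lemma exists_fderiv_comp_normalForm_ne_zero {f : SymBil (Euc n) → ℝ} (hf : ContDiff ℝ ∞ f)
    (w : JetCoord n) (hd : fderiv ℝ f (normalForm w) ≠ 0) :
    ∃ b : SymBil (Euc n), fderiv ℝ (f ∘ normalForm) w (0, 0, 0, b) ≠ 0 := by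
  obtain ⟨b, hb⟩ : ∃ b, fderiv ℝ f (normalForm w) b ≠ 0 := by
    by_contra! hcon
    exact hd (ContinuousLinearMap.ext hcon)
  refine ⟨ofNormalForm b w.2.2.1, ?_⟩
  have h1 : fderiv ℝ (f ∘ normalForm) w (0, 0, 0, ofNormalForm b w.2.2.1) =
      fderiv ℝ f (normalForm w) b :=
    fderiv_eq_of_line ((hf.comp contDiff_normalForm).differentiable (by simp) _)
      (hf.differentiable (by simp) _) fun t => congrArg f (normalForm_line w b t)
  rw [h1]
  exact hb

lemma exists_local_equation_preimage_normalForm {Z : Set (SymBil (Euc n))}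
    (hZ : IsClosedHypersurface Z) {w : JetCoord n} (hw : normalForm w ∈ Z) :
    ∃ f : JetCoord n → ℝ, ContDiff ℝ ∞ f ∧
      (∃ b : SymBil (Euc n), fderiv ℝ f w (0, 0, 0, b) ≠ 0) ∧
      ∀ᶠ z in 𝓝 w, (normalForm z ∈ Z ↔ f z = 0) := by
  obtain ⟨f, hf, hd, hz⟩ := hZ.2 _ hw
  have ht : Filter.Tendsto normalForm (𝓝 w) (𝓝 (normalForm w)) :=
    continuous_normalForm.tendsto w
  exact ⟨f ∘ normalForm, hf.comp (contDiff_normalForm (n := n)),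
    exists_fderiv_comp_normalForm_ne_zero hf w hd, ht.eventually hz⟩

/-- An equation between the invariants defines a second-order PDE, transversal to the fibres. -/
lemma isSecondOrderPDE_of_normalForm (hR : ∀ c z, ∃ a, R c z a)
    (h : ∀ c z a, R c z a → Fhat a = F (normalForm z)) (hF : IsClosedHypersurface {b | F b = 0}) :
    IsSecondOrderPDE R {a | Fhat a = 0} := by
  intro c
  have hE : {z | ∃ a ∈ {a | Fhat a = 0}, R c z a} = {z | normalForm z ∈ {b | F b = 0}} :=
    Set.ext fun z => ⟨fun ⟨a, ha, haz⟩ => (h c z a haz).symm.trans ha, fun hz =>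
      (hR c z).elim fun a ha => ⟨a, (h c z a ha).trans hz, ha⟩⟩
  rw [hE]
  refine ⟨hF.1.preimage (continuous_normalForm (n := n)), fun w hw => ?_⟩
  exact exists_local_equation_preimage_normalForm hF hw

lemma hasDerivAt_smul_const_zero {E : Type*} [NormedAddCommGroup E] [NormedSpace ℝ E] (v : E) :
    HasDerivAt (fun t : ℝ => t • v) v 0 := by
  simpa using (hasDerivAt_id (0 : ℝ)).smul_const v

lemma normalForm_slice (b : SymBil (Euc n)) : normalForm ((0, 0, 0, b) : JetCoord n) = b := by
  have := normalForm_ofNormalForm 0 (0 : Euc n) 0 b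
  rwa [ofNormalForm_zero] at this

/-- A function which vanishes on a level set of the normal form has no derivative transversal
to the second-order coordinates unless it has one along them. -/
lemma fderiv_eq_zero_of_normalForm {f : JetCoord n → ℝ} {b : SymBil (Euc n)}
    (hf : DifferentiableAt ℝ f (0, 0, 0, b))
    (hz : ∀ᶠ z in 𝓝 ((0, 0, 0, b) : JetCoord n), normalForm z = b → f z = 0)
    (hv : ∀ b', fderiv ℝ f (0, 0, 0, b) (0, 0, 0, b') = 0) : fderiv ℝ f (0, 0, 0, b) = 0 := by
  refine ContinuousLinearMap.ext fun w => ?_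
  obtain ⟨u, x, d, b'⟩ := w
  -- This curve keeps the normal form equal to `b`, so `f` vanishes along it, while its velocity has
  -- the arbitrary 1-jet part `(u, x, d)`. What remains of a tangent vector is vertical and is
  -- handled by `hv`.
  set η : ℝ → JetCoord n := fun t => (t • u, t • x, t • d, ofNormalForm b (t • d)) with hη
  have hη0 : η 0 = (0, 0, 0, b) := by
    simp only [hη, zero_smul, ofNormalForm_zero]
  have hof : HasFDerivAt (ofNormalForm b) (fderiv ℝ (ofNormalForm b) 0) ((0 : ℝ) • d) := by
    rw [zero_smul]
    exact ((contDiff_ofNormalForm b).differentiable (by simp) _).hasFDerivAt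
  set m := fderiv ℝ (ofNormalForm b) 0 d
  have hofd : HasDerivAt (fun t : ℝ => ofNormalForm b (t • d)) m 0 :=
    HasFDerivAt.comp_hasDerivAt (f := fun t : ℝ => t • d) 0 hof (hasDerivAt_smul_const_zero d)
  have hηd : HasDerivAt η (u, x, d, m) 0 :=
    (hasDerivAt_smul_const_zero u).prodMk ((hasDerivAt_smul_const_zero x).prodMk
      ((hasDerivAt_smul_const_zero d).prodMk hofd))
  have hzero : f ∘ η =ᶠ[𝓝 0] fun _ => 0 := by
    have ht := hηd.continuousAt.tendsto
    rw [hη0] at ht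
    filter_upwards [ht.eventually hz] with t ht
    exact ht (normalForm_ofNormalForm _ _ _ _)
  have hfη : HasFDerivAt f (fderiv ℝ f (0, 0, 0, b)) (η 0) := by
    rw [hη0]
    exact hf.hasFDerivAt
  have h1 : fderiv ℝ f (0, 0, 0, b) (u, x, d, m) = 0 :=
    (hfη.comp_hasDerivAt 0 hηd).unique ((hasDerivAt_const 0 (0 : ℝ)).congr_of_eventuallyEq hzero)
  have h2 : ((u, x, d, b') : JetCoord n) = (u, x, d, m) + (0, 0, 0, b' - m) := by simp
  rw [h2, map_add, h1, hv, add_zero]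
  rfl

/-- A hypersurface in the space of jet coordinates which is defined in terms of normal forms
intersects the second-order coordinates at a fixed point in a hypersurface. -/
lemma isClosedHypersurface_of_normalForm {Z : Set (SymBil (Euc n))}
    (h : IsClosedHypersurface (normalForm ⁻¹' Z)) : IsClosedHypersurface Z := by
  have hs : ContDiff ℝ ∞ fun b : SymBil (Euc n) => ((0, 0, 0, b) : JetCoord n) :=
    contDiff_const.prodMk (contDiff_const.prodMk (contDiff_const.prodMk contDiff_id))
  have hZ : Z = (fun b : SymBil (Euc n) => ((0, 0, 0, b) : JetCoord n)) ⁻¹' (normalForm ⁻¹' Z) := by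
    ext b
    simp only [Set.mem_preimage, normalForm_slice]
  refine ⟨by rw [hZ]; exact h.1.preimage hs.continuous, fun b hb => ?_⟩
  obtain ⟨f, hf, hd, hz⟩ := h.2 (0, 0, 0, b)
    (by simpa only [Set.mem_preimage, normalForm_slice] using hb)
  refine ⟨fun b => f (0, 0, 0, b), hf.comp hs, fun h0 => hd ?_, ?_⟩
  -- If the sliced equation had zero derivative, all fibre derivatives of `f` would vanish, and then
  -- its whole derivative, since the hypersurface contains a level set of `normalForm` through the
  -- point.
  · refine fderiv_eq_zero_of_normalForm (hf.differentiable (by simp) _) ?_ fun b' => ?_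
    · filter_upwards [hz] with z hz hzb
      refine hz.1 ?_
      rw [Set.mem_preimage, hzb]
      exact hb
    · have h1 : fderiv ℝ f (0, 0, 0, b) (0, 0, 0, b') =
          fderiv ℝ (fun b => f (0, 0, 0, b)) b b' :=
        fderiv_eq_of_line (hf.differentiable (by simp) _)
          ((hf.comp hs).differentiable (by simp) _) (fun t => by simp)
      rw [h1, h0]
      rfl
  · have := hs.continuous.continuousAt.eventually hz
    filter_upwards [this] with b' hb'
    rw [← hb', Set.mem_preimage, normalForm_slice]

/-- An invariant hypersurface of the space of cooriented 2-jets is given by a closed hypersurface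
in the space of normal forms. -/
lemma exists_normalForm_hypersurface (hn : 1 ≤ n) {E : Set (CoJet n)}
    (hE : IsJetHypersurface CoJet.HasCoord E) (hinv : IsInvariantSet CoJet.move E) :
    ∃ Z : Set (SymBil (Euc n)), IsClosedHypersurface Z ∧
      ∀ (a : CoJet n) (b : SymBil (Euc n)), a.sigmaHat = sigmaOf n b → (a ∈ E ↔ b ∈ Z) := by
  have hsat : ∀ a a' : CoJet n, a.sigmaHat = a'.sigmaHat → a ∈ E → a' ∈ E := by
    intro a a' h ha
    obtain ⟨g, hg, rfl⟩ := CoJet.exists_move_eq hn h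
    exact hinv g hg a ha
  -- A single chart suffices: its cooriented jets realise every normal form, and membership in `E`
  -- depends only on the invariants.
  let c : Isom n := AffineIsometryEquiv.refl ℝ _
  let Z : Set (SymBil (Euc n)) := {b | ∃ a ∈ E, a.sigmaHat = sigmaOf n b}
  have hZ : {z | ∃ a ∈ E, CoJet.HasCoord c z a} = normalForm ⁻¹' Z := by
    ext z
    constructor
    · rintro ⟨a, ha, haz⟩
      exact ⟨a, ha, haz.sigmaHat_eq⟩
    · rintro ⟨a, ha, haz⟩
      obtain ⟨a', ha'⟩ := exists_coJet_hasCoord c z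
      exact ⟨a', hsat a a' (haz.trans ha'.sigmaHat_eq.symm) ha, ha'⟩
  refine ⟨Z, isClosedHypersurface_of_normalForm (hZ ▸ hE c), fun a b hab => ⟨fun ha => ⟨a, ha, hab⟩,
    fun ⟨a', ha', h⟩ => hsat a' a (h.trans hab.symm) ha'⟩⟩

end PDE

/-! ### Extensions of invariant functions -/

section Extension

variable {n : ℕ} {a₁ : Jet n 1} {ξ : Covector n} {ι : Fibre a₁ ≃ SymBil (Hyp ξ)}

lemma signFlip_signFlip (s : Fin n → ℝ) : signFlip (signFlip s) = s := by
  funext k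
  rw [signFlip, signFlip, ← mul_assoc, ← pow_add, Even.neg_one_pow ⟨_, rfl⟩, one_mul]

lemma contDiff_signFlip : ContDiff ℝ ∞ (signFlip : (Fin n → ℝ) → Fin n → ℝ) :=
  contDiff_pi.2 fun k => contDiff_const.mul (contDiff_apply ℝ ℝ k)

lemma sigma_neg (hξ : ξ ≠ 0) (β : SymBil (Hyp ξ)) : sigma (-β) = signFlip (sigma β) :=
  sigmaOf_neg (finrank_hyp hξ) β

lemma exists_hyp_isometry (hξ : ξ ≠ 0) : Nonempty (Hyp ξ ≃ₗᵢ[ℝ] Euc n) := by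
  obtain ⟨-, B, -⟩ := exists_diagForm (finrank_hyp hξ) 0
  exact ⟨B⟩

/-- Every value of the invariants is attained on every hyperplane. -/
lemma exists_sigma_eq (hξ : ξ ≠ 0) (a : CoJet n) : ∃ β : SymBil (Hyp ξ), sigma β = a.sigmaHat := by
  obtain ⟨B⟩ := exists_hyp_isometry hξ
  obtain ⟨C⟩ := exists_hyp_isometry a.isUnitConormal.ne_zero
  refine ⟨pullbackEquiv (B.trans C.symm).toContinuousLinearEquiv a.sff, ?_⟩
  rw [sigma_eq_sigmaOf, sigmaOf_pullback]
  rfl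

lemma sigma_fibre (hι : ∀ (a : Fibre a₁) (β : SymBil (Hyp ξ)), IsSFF a.1 ξ β ↔ ι a = β)
    (a : CoJet n) (h : a.jet.proj = a₁) (hc : a.conormal = ξ) :
    sigma (ι ⟨a.jet, h⟩) = a.sigmaHat := by
  subst hc
  exact (CoJet.sigmaHat_eq ((hι ⟨a.jet, h⟩ _).2 rfl)).symm

/-- The cooriented jet with a given second fundamental form in the fibre over `(a₁, ξ)`. -/
lemma exists_coJet_fibre (hξ : IsUnitConormal a₁ ξ) (ι : Fibre a₁ ≃ SymBil (Hyp ξ))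
    (β : SymBil (Hyp ξ)) :
    ∃ (a : CoJet n) (h : a.jet.proj = a₁), a.conormal = ξ ∧ ι ⟨a.jet, h⟩ = β := by
  refine ⟨⟨(ι.symm β).1, ξ, by rw [(ι.symm β).2]; exact hξ⟩, (ι.symm β).2, rfl, ?_⟩
  exact ι.apply_symm_apply β

lemma isCoExtension_sigmaHat
    (hι : ∀ (a : Fibre a₁) (β : SymBil (Hyp ξ)), IsSFF a.1 ξ β ↔ ι a = β)
    {F : SymBil (Hyp ξ) → ℝ} {Φ : (Fin n → ℝ) → ℝ} (hF : ∀ β, F β = Φ (sigma β)) :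
    IsCoExtension ι F fun a => Φ a.sigmaHat :=
  ⟨fun g _ a => congrArg Φ (CoJet.sigmaHat_move g a), fun a h hc => by
    rw [hF, sigma_fibre hι a h hc]⟩

/-- Every orbit meets the fibre over `(a₁, ξ)`, because that fibre attains all values of the
invariants and these separate orbits. So the values of `F` on this fibre determine any invariant
extension. -/
lemma IsCoExtension.eq_sigmaHat (hn : 1 ≤ n) (hξ : IsUnitConormal a₁ ξ)
    (hι : ∀ (a : Fibre a₁) (β : SymBil (Hyp ξ)), IsSFF a.1 ξ β ↔ ι a = β)
    {F : SymBil (Hyp ξ) → ℝ} {Φ : (Fin n → ℝ) → ℝ} (hF : ∀ β, F β = Φ (sigma β))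
    {Fhat : CoJet n → ℝ} (h : IsCoExtension ι F Fhat) (a : CoJet n) : Fhat a = Φ a.sigmaHat := by
  obtain ⟨β, hβ⟩ := exists_sigma_eq hξ.ne_zero a
  obtain ⟨b, hb, hbc, hbβ⟩ := exists_coJet_fibre hξ ι β
  have hs : a.sigmaHat = b.sigmaHat := by
    rw [← sigma_fibre hι b hb hbc, hbβ, hβ]
  obtain ⟨g, hg, hgb⟩ := CoJet.exists_move_eq hn hs
  rw [← h.1 g hg a, hgb, h.2 b hb hbc, hbβ, hF, hβ]

lemma IsExtension.isCoExtension {F : SymBil (Hyp ξ) → ℝ} {Fhat : Jet n 2 → ℝ}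
    (h : IsExtension ι F Fhat) : IsCoExtension ι F fun a => Fhat a.jet :=
  ⟨fun g hg a => h.1 g hg a.jet, fun a ha _ => h.2 a.jet ha⟩

/-- A function of the invariants in terms of normal forms. -/
lemma exists_normalForm_fun (hξ : ξ ≠ 0) {F : SymBil (Hyp ξ) → ℝ} {Φ : (Fin n → ℝ) → ℝ}
    (hF : ∀ β, F β = Φ (sigma β)) :
    ∃ e : SymBil (Euc n) ≃L[ℝ] SymBil (Hyp ξ), ∀ b, F (e b) = Φ (sigmaOf n b) := by
  obtain ⟨B⟩ := exists_hyp_isometry hξ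
  refine ⟨pullbackEquiv B.toContinuousLinearEquiv, fun b => ?_⟩
  rw [hF, sigma_eq_sigmaOf, sigmaOf_pullback]

/-- Smoothness of the extension, and the PDE it defines. -/
lemma smooth_and_pde (hξ : ξ ≠ 0) {F : SymBil (Hyp ξ) → ℝ} {Φ : (Fin n → ℝ) → ℝ}
    (hF : ∀ β, F β = Φ (sigma β)) {T : Type} {R : Isom n → JetCoord n → T → Prop} {Fhat : T → ℝ}
    (hR : ∀ c z, ∃ a, R c z a) (h : ∀ c z a, R c z a → Fhat a = Φ (sigmaOf n (normalForm z))) :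
    (ContDiff ℝ ∞ F → IsSmoothOnJets R Fhat) ∧
      (IsClosedHypersurface {β | F β = 0} → IsSecondOrderPDE R {a | Fhat a = 0}) := by
  obtain ⟨e, he⟩ := exists_normalForm_fun hξ hF
  have h' : ∀ c z a, R c z a → Fhat a = F (e (normalForm z)) := fun c z a hz =>
    (h c z a hz).trans (he _).symm
  exact ⟨fun hs => isSmoothOnJets_of_normalForm (contDiff_comp_symBil e hs) h', fun hc =>
    isSecondOrderPDE_of_normalForm hR h' (IsClosedHypersurface.preimage_symBil e hc)⟩

lemma isInvariantSet_of_isInvariantFun {T : Type} {act : Isom n → T → T} {Fhat : T → ℝ}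
    (h : IsInvariantFun act Fhat) : IsInvariantSet act {a | Fhat a = 0} :=
  fun g hg a ha => (h g hg a).trans ha

lemma isClosedHypersurface_sigma (hξ : ξ ≠ 0) {Z : Set (SymBil (Euc n))}
    (hZ : IsClosedHypersurface Z) {Φ : (Fin n → ℝ) → ℝ}
    (hΦZ : ∀ β, Φ (sigmaOf n β) = 0 ↔ β ∈ Z) :
    IsClosedHypersurface {β : SymBil (Hyp ξ) | Φ (sigma β) = 0} := by
  obtain ⟨B⟩ := exists_hyp_isometry hξ
  have hβ : ∀ β : SymBil (Hyp ξ), Φ (sigma β) = 0 ↔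
      pullbackEquiv B.symm.toContinuousLinearEquiv β ∈ Z := fun β => by
    rw [← hΦZ, sigmaOf_pullback]
    rfl
  have hpre : {β : SymBil (Hyp ξ) | Φ (sigma β) = 0} =
      {β | pullbackEquiv B.symm.toContinuousLinearEquiv β ∈ Z} := Set.ext hβ
  rw [hpre]
  exact IsClosedHypersurface.preimage_symBil _ hZ

lemma CoJet.exists_sigmaOf_eq (a : CoJet n) : ∃ b : SymBil (Euc n), a.sigmaHat = sigmaOf n b := by
  obtain ⟨B⟩ := exists_hyp_isometry a.isUnitConormal.ne_zero
  exact ⟨pullbackEquiv B.symm.toContinuousLinearEquiv a.sff, (sigmaOf_pullback n _ _).symm⟩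

lemma exists_coJet_sigmaHat_eq (b : SymBil (Euc n)) : ∃ a : CoJet n, a.sigmaHat = sigmaOf n b := by
  obtain ⟨a, ha⟩ := exists_coJet_hasCoord (AffineIsometryEquiv.refl ℝ _) (0, 0, 0, b)
  exact ⟨a, by rw [ha.sigmaHat_eq, normalForm_slice]⟩

/-- Invariant hypersurfaces of the space of cooriented 2-jets are zero sets of smooth functions
of the invariants. -/
lemma exists_smooth_equation (hn : 1 ≤ n) (hξ : ξ ≠ 0) {E : Set (CoJet n)}
    (hE : IsJetHypersurface CoJet.HasCoord E) (hinv : IsInvariantSet CoJet.move E) :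
    ∃ Φ : (Fin n → ℝ) → ℝ, ContDiff ℝ ∞ Φ ∧
      IsClosedHypersurface {β : SymBil (Hyp ξ) | Φ (sigma β) = 0} ∧
      ∀ a, a ∈ E ↔ Φ a.sigmaHat = 0 := by
  obtain ⟨Z, hZ, hEZ⟩ := exists_normalForm_hypersurface hn hE hinv
  -- Two forms with equal invariants are both represented by one cooriented jet, so `Z` is a union
  -- of level sets.
  obtain ⟨Φ, hΦ, hΦZ⟩ := exists_contDiff_zeroSet_sigmaOf hZ.1 fun b hb b' h => by
    obtain ⟨a, ha⟩ := exists_coJet_sigmaHat_eq b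
    exact (hEZ a b' (ha.trans h.symm)).1 ((hEZ a b ha).2 hb)
  refine ⟨Φ, hΦ, isClosedHypersurface_sigma hξ hZ hΦZ, fun a => ?_⟩
  obtain ⟨b, hs⟩ := a.exists_sigmaOf_eq
  rw [hEZ a b hs, hs, hΦZ]

/-- Functions of the invariants that are even descend to jets without coorientation. -/
lemma exists_isExtension (hξ : IsUnitConormal a₁ ξ)
    (hι : ∀ (a : Fibre a₁) (β : SymBil (Hyp ξ)), IsSFF a.1 ξ β ↔ ι a = β)
    {F : SymBil (Hyp ξ) → ℝ} {Φ : (Fin n → ℝ) → ℝ} (hF : ∀ β, F β = Φ (sigma β))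
    (heven : ∀ β, F (-β) = F β) :
    ∃ Fhat : Jet n 2 → ℝ, IsExtension ι F Fhat ∧ ∀ a : CoJet n, Fhat a.jet = Φ a.sigmaHat := by
  -- An arbitrary coorientation is chosen for each jet; evenness makes the value of `Φ` independent
  -- of that choice.
  choose co hco using CoJet.exists_jet_eq (n := n)
  have key : ∀ a : CoJet n, Φ (co a.jet).sigmaHat = Φ a.sigmaHat := by
    intro a
    rcases CoJet.eq_or_eq_flip (hco a.jet).symm with h | h
    · rw [h]
    · obtain ⟨β, hβ⟩ := exists_sigma_eq hξ.ne_zero a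
      rw [h, CoJet.sigmaHat_flip, ← hβ, ← sigma_neg hξ.ne_zero, ← hF, ← hF, heven]
  refine ⟨fun j => Φ (co j).sigmaHat, ⟨fun g _ j => ?_, fun j hj => ?_⟩, key⟩
  · show Φ (co (j.move g)).sigmaHat = Φ (co j).sigmaHat
    have h1 := key ((co j).move g)
    rw [CoJet.sigmaHat_move] at h1
    have h2 : ((co j).move g).jet = j.move g := congrArg (Jet.move g) (hco j)
    rwa [h2] at h1
  · have hu : IsUnitConormal j.proj ξ := by rw [hj]; exact hξ
    have h1 := key ⟨j, ξ, hu⟩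
    show Φ (co j).sigmaHat = _
    rw [h1, hF, sigma_fibre hι ⟨j, ξ, hu⟩ hj rfl]

/-- A function with an invariant extension to jets without coorientation is even. -/
lemma IsExtension.even (hn : 1 ≤ n) (hξ : IsUnitConormal a₁ ξ)
    (hι : ∀ (a : Fibre a₁) (β : SymBil (Hyp ξ)), IsSFF a.1 ξ β ↔ ι a = β)
    {F : SymBil (Hyp ξ) → ℝ} {Φ : (Fin n → ℝ) → ℝ} (hF : ∀ β, F β = Φ (sigma β))
    {Fhat : Jet n 2 → ℝ} (h : IsExtension ι F Fhat) (β : SymBil (Hyp ξ)) : F (-β) = F β := by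
  obtain ⟨a, ha, hac, haβ⟩ := exists_coJet_fibre hξ ι β
  have hs : sigma β = a.sigmaHat := by rw [← haβ, sigma_fibre hι a ha hac]
  have key := h.isCoExtension.eq_sigmaHat hn hξ hι hF
  -- The cooriented jets `a` and `a.flip` have the same underlying jet, on which the extension takes
  -- a single value.
  rw [hF, hF, sigma_neg hξ.ne_zero, hs, ← CoJet.sigmaHat_flip, ← key, ← key]
  rfl

/-- An even function of the invariants with the same zeros, when these are symmetric. -/
def evenSquare (Φ : (Fin n → ℝ) → ℝ) (s : Fin n → ℝ) : ℝ := Φ s ^ 2 + Φ (signFlip s) ^ 2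

lemma contDiff_evenSquare {Φ : (Fin n → ℝ) → ℝ} (h : ContDiff ℝ ∞ Φ) :
    ContDiff ℝ ∞ (evenSquare Φ) :=
  (h.pow 2).add ((h.comp contDiff_signFlip).pow 2)

lemma evenSquare_signFlip (Φ : (Fin n → ℝ) → ℝ) (s : Fin n → ℝ) :
    evenSquare Φ (signFlip s) = evenSquare Φ s := by
  rw [evenSquare, evenSquare, signFlip_signFlip, add_comm]

lemma evenSquare_eq_zero {Φ : (Fin n → ℝ) → ℝ} {s : Fin n → ℝ}
    (h : Φ (signFlip s) = 0 ↔ Φ s = 0) : evenSquare Φ s = 0 ↔ Φ s = 0 := by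
  rw [evenSquare, add_eq_zero_iff_of_nonneg (sq_nonneg _) (sq_nonneg _),
    pow_eq_zero_iff two_ne_zero, pow_eq_zero_iff two_ne_zero, h, and_self]

/-- Each coordinate value belongs to one jet and to an upward cooriented lift of it, so `E` and its
preimage have the same coordinate sets. -/
lemma isJetHypersurface_preimage {E : Set (Jet n 2)} (hE : IsJetHypersurface Jet.HasCoord E) :
    IsJetHypersurface CoJet.HasCoord (CoJet.jet ⁻¹' E) := by
  intro c
  have h : {z | ∃ a ∈ CoJet.jet ⁻¹' E, CoJet.HasCoord c z a} =
      {z | ∃ a ∈ E, Jet.HasCoord c z a} := Set.ext fun z =>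
    ⟨fun ⟨a, ha, haz⟩ => ⟨a.jet, ha, haz.1⟩, fun ⟨j, hj, hjz⟩ => by
      obtain ⟨a, ha⟩ := exists_coJet_hasCoord c z
      exact ⟨a, by rw [Set.mem_preimage, ha.1]; exact Eq.subst hjz hj, ha⟩⟩
  rw [h]
  exact hE c

/-- Invariant hypersurfaces of the space of 2-jets are zero sets of smooth even functions of the
invariants. -/
lemma exists_smooth_even_equation (hn : 1 ≤ n) (hξ : IsUnitConormal a₁ ξ)
    (hι : ∀ (a : Fibre a₁) (β : SymBil (Hyp ξ)), IsSFF a.1 ξ β ↔ ι a = β) {E : Set (Jet n 2)}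
    (hE : IsJetHypersurface Jet.HasCoord E) (hinv : IsInvariantSet Jet.move E) :
    ∃ Φ : (Fin n → ℝ) → ℝ, ContDiff ℝ ∞ Φ ∧
      IsClosedHypersurface {β : SymBil (Hyp ξ) | Φ (sigma β) = 0} ∧
      (∀ β : SymBil (Hyp ξ), Φ (sigma (-β)) = Φ (sigma β)) ∧
      ∀ a : CoJet n, a.jet ∈ E ↔ Φ a.sigmaHat = 0 := by
  obtain ⟨Φ, hΦ, hc, hEΦ⟩ := exists_smooth_equation hn hξ.ne_zero
    (isJetHypersurface_preimage hE) fun g hg a ha => hinv g hg a.jet ha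
  -- The function `Φ` itself need not be even, but its zero set is symmetric, since the preimage of
  -- `E` contains both coorientations of a jet or neither. Symmetrising by squares therefore keeps
  -- the zeros.
  have hzero : ∀ a : CoJet n, evenSquare Φ a.sigmaHat = 0 ↔ Φ a.sigmaHat = 0 := fun a => by
    refine evenSquare_eq_zero ?_
    rw [← CoJet.sigmaHat_flip, ← hEΦ, ← hEΦ]
    rfl
  refine ⟨evenSquare Φ, contDiff_evenSquare hΦ, ?_, fun β => ?_, fun a => ?_⟩
  · have h : {β : SymBil (Hyp ξ) | evenSquare Φ (sigma β) = 0} = {β | Φ (sigma β) = 0} := by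
      refine Set.ext fun β => ?_
      obtain ⟨a, ha, hac, haβ⟩ := exists_coJet_fibre hξ ι β
      have hs : sigma β = a.sigmaHat := by rw [← haβ, sigma_fibre hι a ha hac]
      rw [Set.mem_ofPred_eq, Set.mem_ofPred_eq, hs, hzero]
    rw [h]
    exact hc
  · rw [sigma_neg hξ.ne_zero, evenSquare_signFlip]
  · rw [hzero, ← hEΦ]
    rfl

end Extension

end EuclideanJets

end

set_option maxHeartbeats 1000000 in
theorem mainTheorem5 (n : ℕ) (hn : 1 ≤ n) :
    -- `J¹ ≃ ℙ T*𝔼ⁿ⁺¹`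
    (∃ Θ : Jet n 1 ≃ Euc (n + 1) × Projectivization ℝ (Covector n),
      ∀ a : Jet n 1, (Θ a).1 = a.base ∧
        ∀ (ξ : Covector n) (hξ : ξ ≠ 0), IsConormal a ξ ↔ (Θ a).2 = Projectivization.mk ℝ ξ hξ) ∧
    ∀ (a₁ : Jet n 1) (ξ : Covector n), IsUnitConormal a₁ ξ →
      -- the fibre over `a₁ = [ξ]` is identified with `S²V*` by the second fundamental form
      ∃ ι : Fibre a₁ ≃ SymBil (Hyp ξ),
        (∀ (a : Fibre a₁) (β : SymBil (Hyp ξ)), IsSFF a.1 ξ β ↔ ι a = β) ∧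
        (∀ (c : Isom n) (u : ℝ) (x : Euc n) (d : Euc n →L[ℝ] ℝ)
          (h : ∀ b, (jetWithCoord c (u, x, d, b)).proj = a₁),
          ∃ L : SymBil (Euc n) ≃L[ℝ] SymBil (Hyp ξ),
            ∀ b, ι ⟨jetWithCoord c (u, x, d, b), h b⟩ = L b) ∧
        -- `SO(V)`-invariant functions are the functions of `σ₁, …, σₙ`
        (∀ F : SymBil (Hyp ξ) → ℝ,
          IsSOInvariant F ↔ ∃ Φ : (Fin n → ℝ) → ℝ, ∀ β, F β = Φ (sigma β)) ∧
        -- cooriented hypersurfaces: from functions to invariant PDEs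
        (∀ F : SymBil (Hyp ξ) → ℝ, IsSOInvariant F →
          (∃! Fhat : CoJet n → ℝ, IsCoExtension ι F Fhat) ∧
          ∀ Fhat : CoJet n → ℝ, IsCoExtension ι F Fhat →
            (∀ Φ : (Fin n → ℝ) → ℝ, (∀ β, F β = Φ (sigma β)) →
              ∀ (a : CoJet n) (β : SymBil (Hyp a.conormal)),
                IsSFF a.jet a.conormal β → Fhat a = Φ (sigma β)) ∧
            (ContDiff ℝ ∞ F → IsSmoothOnJets CoJet.HasCoord Fhat) ∧
            IsInvariantSet CoJet.move {a | Fhat a = 0} ∧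
            (IsClosedHypersurface {β | F β = 0} →
              IsSecondOrderPDE CoJet.HasCoord {a | Fhat a = 0})) ∧
        -- cooriented hypersurfaces: every invariant PDE is of this form
        (∀ E : Set (CoJet n), IsJetHypersurface CoJet.HasCoord E → IsInvariantSet CoJet.move E →
          ∃ Φ : (Fin n → ℝ) → ℝ, ContDiff ℝ ∞ Φ ∧
            IsClosedHypersurface {β : SymBil (Hyp ξ) | Φ (sigma β) = 0} ∧
            ∃ Fhat : CoJet n → ℝ, IsCoExtension ι (fun β => Φ (sigma β)) Fhat ∧
              E = {a | Fhat a = 0}) ∧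
        -- hypersurfaces without coorientation: from functions to invariant PDEs
        (∀ F : SymBil (Hyp ξ) → ℝ, IsSOInvariant F →
          ((∃ Fhat : Jet n 2 → ℝ, IsExtension ι F Fhat) ↔ ∀ β, F (-β) = F β) ∧
          ∀ Fhat : Jet n 2 → ℝ, IsExtension ι F Fhat →
            (∀ Fhat' : Jet n 2 → ℝ, IsExtension ι F Fhat' → Fhat' = Fhat) ∧
            (∀ Φ : (Fin n → ℝ) → ℝ, (∀ β, F β = Φ (sigma β)) →
              ∀ (a : Jet n 2) (η : Covector n) (β : SymBil (Hyp η)),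
                IsUnitConormal a.proj η → IsSFF a η β → Fhat a = Φ (sigma β)) ∧
            (ContDiff ℝ ∞ F → IsSmoothOnJets Jet.HasCoord Fhat) ∧
            IsInvariantSet Jet.move {a | Fhat a = 0} ∧
            (IsClosedHypersurface {β | F β = 0} →
              IsSecondOrderPDE Jet.HasCoord {a | Fhat a = 0})) ∧
        -- hypersurfaces without coorientation: every invariant PDE is of this form
        (∀ E : Set (Jet n 2), IsJetHypersurface Jet.HasCoord E → IsInvariantSet Jet.move E →
          ∃ Φ : (Fin n → ℝ) → ℝ, ContDiff ℝ ∞ Φ ∧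
            IsClosedHypersurface {β : SymBil (Hyp ξ) | Φ (sigma β) = 0} ∧
            ∃ Fhat : Jet n 2 → ℝ, IsExtension ι (fun β => Φ (sigma β)) Fhat ∧
              E = {a | Fhat a = 0}) := by
  refine ⟨exists_equiv_projectivization, fun a₁ ξ hξ => ?_⟩
  have h0 := hξ.ne_zero
  obtain ⟨ι, hι⟩ := exists_fibre_equiv hξ
  have hco : ∀ (c : Isom n) (z : JetCoord n), ∃ a : Jet n 2, Jet.HasCoord c z a :=
    fun c z => ⟨_, rfl⟩
  refine ⟨ι, hι, exists_linear_coord hξ hι, isSOInvariant_iff hn h0, ?_, ?_, ?_, ?_⟩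
  · intro F hF
    obtain ⟨Φ, hΦ⟩ := (isSOInvariant_iff hn h0 F).1 hF
    refine ⟨⟨_, isCoExtension_sigmaHat hι hΦ, fun G hG =>
      funext (hG.eq_sigmaHat hn hξ hι hΦ)⟩, fun Fhat hFhat => ?_⟩
    have hpde := smooth_and_pde h0 hΦ exists_coJet_hasCoord (Fhat := Fhat) fun c z a hz => by
      rw [hFhat.eq_sigmaHat hn hξ hι hΦ, hz.sigmaHat_eq]
    refine ⟨fun Ψ hΨ a β hβ => ?_, hpde.1, isInvariantSet_of_isInvariantFun hFhat.1, hpde.2⟩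
    rw [hFhat.eq_sigmaHat hn hξ hι hΨ, CoJet.sigmaHat_eq hβ]
  · intro E hE hinv
    obtain ⟨Φ, hΦ, hc, hEΦ⟩ := exists_smooth_equation hn h0 hE hinv
    exact ⟨Φ, hΦ, hc, _, isCoExtension_sigmaHat hι fun _ => rfl, Set.ext hEΦ⟩
  · intro F hF
    obtain ⟨Φ, hΦ⟩ := (isSOInvariant_iff hn h0 F).1 hF
    refine ⟨⟨fun ⟨Fhat, h⟩ => h.even hn hξ hι hΦ, fun h => ?_⟩, fun Fhat hFhat => ?_⟩
    · obtain ⟨Fhat, h, -⟩ := exists_isExtension hξ hι hΦ h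
      exact ⟨Fhat, h⟩
    have key : ∀ (G : Jet n 2 → ℝ), IsExtension ι F G → ∀ (Ψ : (Fin n → ℝ) → ℝ),
        (∀ β, F β = Ψ (sigma β)) → ∀ a : CoJet n, G a.jet = Ψ a.sigmaHat :=
      fun G hG Ψ hΨ => hG.isCoExtension.eq_sigmaHat hn hξ hι hΨ
    -- In each chart the jet is replaced by its upward cooriented lift, where the invariants are
    -- those of the normal form.
    have hpde := smooth_and_pde h0 hΦ hco (Fhat := Fhat) fun c z j hj => by
      obtain ⟨a, ha⟩ := exists_coJet_hasCoord c z
      rw [show j = a.jet from Eq.trans hj ha.1.symm, key Fhat hFhat Φ hΦ, ha.sigmaHat_eq]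
    refine ⟨fun G hG => funext fun j => ?_, fun Ψ hΨ j η β hη hβ => ?_, hpde.1,
      isInvariantSet_of_isInvariantFun hFhat.1, hpde.2⟩
    · obtain ⟨a, rfl⟩ := CoJet.exists_jet_eq j
      rw [key G hG Φ hΦ, key Fhat hFhat Φ hΦ]
    · rw [key Fhat hFhat Ψ hΨ ⟨j, η, hη⟩]
      exact congrArg Ψ (CoJet.sigmaHat_eq (a := ⟨j, η, hη⟩) hβ)
  · intro E hE hinv
    obtain ⟨Φ, hΦ, hc, heven, hEΦ⟩ := exists_smooth_even_equation hn hξ hι hE hinv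
    obtain ⟨Fhat, hFhat, hFa⟩ := exists_isExtension (F := fun β => Φ (sigma β)) hξ hι
      (fun _ => rfl) heven
    refine ⟨Φ, hΦ, hc, Fhat, hFhat, Set.ext fun j => ?_⟩
    obtain ⟨a, rfl⟩ := CoJet.exists_jet_eq j
    rw [Set.mem_ofPred_eq, hFa, hEΦ]
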